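/- **Setting.** Let $d\ge1$, $\Omega=\prod_{i=1}^d(a_i,b_i)\subset\mathbb R^d$ a box, $V=H^1_0(\Omega)$ or $V=H^1_p(\Omega)$ (periodic functions), with real or complex scalars, $\|v\|_V^2=\int_\Omega|v|^2+|\nabla v|^2$, and let $Lu=-\nabla\cdot(\nu\nabla u)+\sigma u$ with real coefficients $0<\nu_*\le\nu\le\nu^*$, $0<\sigma_*\le\sigma\le\sigma^*$ in $\Omega$, $\alpha_*=\min(\nu_*,\sigma_*)$, $\alpha^*=\max(\nu^*,\sigma^*)$, $a(u,v)=\int_\Omega\nu\nabla u\cdot\nabla\bar v+\sigma u\bar v$, $|||v|||=\sqrt{a(v,v)}$. Let $(\phi_k)_{k\in\mathcal K}$, $\mathcal K\subseteq\mathbb Z^d$, be a Riesz basis of $V$ with weights $d_k>0$: $v=\sum_k\hat v_k\phi_k\mapsto(\hat v_k\sqrt{d_k})_k$ is an isomorphism of $V$ onto $\ell^2(\mathcal K)$ and $\beta_*\|v\|_V\le\|v\|_\phi:=(\sum_k|\hat v_k|^2d_k)^{1/2}\le\beta^*\|v\|_V$, $\beta_*>0$. For a functional $g$ on $V$ put $\hat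 g_k=\langle g,\phi_k\rangle$ and $\|g\|_{\phi^*}=(\sum_k|\hat g_k|^2d_k^{-1})^{1/2}$. Assume that the (normalized) stiffness matrix $\mathbf A=(a(\phi_k,\phi_\ell)/\sqrt{d_\ell d_k})_{\ell,k}$ satisfies $|\mathbf A_{\ell,k}|\le c_Le^{-\eta_L|\ell-k|}$ with some $\eta_L>0$, where $|\cdot|$ is the Euclidean norm. Let $C_{\mathbf A^{-1}},\tilde\eta_L>0$ be such that $\|\mathbf A^{-1}-(\mathbf A^{-1})_J\|\le C_{\mathbf A^{-1}}e^{-\tilde\eta_LJ}$ for all $J\ge0$, where $(\mathbf A^{-1})_J$ keeps the entries with $|\ell-k|\le J$ and the norm is that of operators on $\ell^2(\mathcal K)$, and let $0<C_0\le\frac14\sqrt{\alpha_*/\alpha^*}\,\beta_*/\beta^*$. **Algorithm DYN-GAL($\varepsilon$)** for $f\in V^*$, $f\ne0$: start with $\Lambda_0=\emptyset$, $u_0=0$. For $n=0,1,2,\dots$ let $r_n=f-Lu_n$ and $\theta_n=(1-C_0^2\|r_n\|_{\phi^*}^2/\|f\|_{\phi^*}^2)^{1/2}$; let $\widetilde{\partial\Lambda}_n\subset\mathcal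 K$ be a set of minimal cardinality with $\sum_{k\in\widetilde{\partial\Lambda}_n}|\hat r_{n,k}|^2d_k^{-1}\ge\theta_n^2\|r_n\|_{\phi^*}^2$; let $J_n=J_n^0+\delta_n$, where $\delta_n\in[0,1)$ is a rounding and $J_n^0$ is the smallest $J\ge0$ with $C_{\mathbf A^{-1}}e^{-\tilde\eta_LJ}\le\sqrt{(1-\theta_n^2)/(\alpha_*\alpha^*)}$; let $\Lambda_{n+1}=\Lambda_n\cup\{k\in\mathcal K:|k-\ell|\le J_n\text{ for some }\ell\in\widetilde{\partial\Lambda}_n\}$ and let $u_{n+1}$ be the Galerkin solution in $V_{\Lambda_{n+1}}=\mathrm{span}\{\phi_k:k\in\Lambda_{n+1}\}$. Stop at the first $n$ with $\|r_{n+1}\|_{\phi^*}\le\varepsilon\|f\|_{\phi^*}$. **Gevrey class.** Let $\omega_d$ be the volume of the unit ball of $\mathbb R^d$ and $E_N(v)=\inf_{|\Lambda|=N}\|v-\sum_{k\in\Lambda}\hat v_k\phi_k\|_\phi$. For $\eta>0$, $0<t\le d$, $\mathcal A_G^{\eta,t}$ is the set of $v\in V$ with $\|v\|_{\mathcal A_G^{\eta,t}}=\sup_{N\ge0}E_N(v)\exp(\eta\,\omega_d^{-t/d}N^{t/d})<\infty$.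 **Theorem 5.1 (exponential convergence rate).** For all $\eta>0$, $0<t\le d$ there are $C_*>0$, $\eta_*\in(0,\eta)$ and $t_*\in(0,t)$, independent of $f$, $u$, $\varepsilon$ and the number of iterations, such that, whenever $f\ne0$, the solution $u\in V$ of $Lu=f$ lies in $\mathcal A_G^{\eta,t}$ and $0<\varepsilon<1$, upon termination of DYN-GAL($\varepsilon$) $$|||u-u_{n+1}|||\le\frac{\beta^*}{\sqrt{\alpha_*}}\|f\|_{\phi^*}\,\varepsilon,\qquad |\Lambda_{n+1}|\le\omega_d\Big(\frac1{\eta_*}\log\frac{C_*\|u\|_{\mathcal A_G^{\eta,t}}/\|f\|_{\phi^*}}{\varepsilon}\Big)^{d/t_*}.$$ Moreover, suppose that a linear solver solves every Galerkin system $\mathbf A_\Lambda x=g$ with at most $C_\#|\Lambda|$ arithmetic operations, and let the workload $\mathcal W_\varepsilon$ be the total number of operations to find, plus one unit per coefficient to store, the iterates $u_1,\dots,u_{n+1}$. Then there is $\eta^*\in(0,\eta_*)$ (depending also on $C_\#$) and, for each $\delta>0$, a constant $C^*>C_*$ such that, for all $f,u$ as above and all $\varepsilon\in(0,1)$ with $|\log|\log\varepsilon||\ge\delta$,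 upon termination $$\mathcal W_\varepsilon\le\omega_d\Big(\frac1{\eta^*}\log\frac{C^*\|u\|_{\mathcal A_G^{\eta,t}}/\|f\|_{\phi^*}}{\varepsilon^4|\log|\log\varepsilon||^{-1}}\Big)^{d/t_*}.$$ -/

import Mathlib

open MeasureTheory
open scoped ContDiff ENNReal ComplexConjugate

noncomputable section

namespace DynGal

/-! ### The elliptic boundary value problem on a box -/

/-- Periodic or homogeneous Dirichlet boundary conditions. -/
inductive BoundaryCondition where
  | periodic
  | dirichlet

/-- The data of `-∇·(ν ∇u) + σ u = f` in the box `Ω = ∏ (a i, b i)`: boundary condition and real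
coefficients, bounded above and below by positive constants. -/
structure EllipticProblem (d : ℕ) where
  a : Fin d → ℝ
  b : Fin d → ℝ
  a_lt_b : ∀ i, a i < b i
  bc : BoundaryCondition
  ν : EuclideanSpace ℝ (Fin d) → ℝ
  σ : EuclideanSpace ℝ (Fin d) → ℝ
  νLo : ℝ
  νHi : ℝ
  σLo : ℝ
  σHi : ℝ
  νLo_pos : 0 < νLo
  σLo_pos : 0 < σLo
  ν_meas : AEMeasurable ν (volume.restrict {x | ∀ i, x i ∈ Set.Ioo (a i) (b i)})
  σ_meas : AEMeasurable σ (volume.restrict {x | ∀ i, x i ∈ Set.Ioo (a i) (b i)})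
  ν_bounds : ∀ x : EuclideanSpace ℝ (Fin d), (∀ i, x i ∈ Set.Ioo (a i) (b i)) →
    νLo ≤ ν x ∧ ν x ≤ νHi
  σ_bounds : ∀ x : EuclideanSpace ℝ (Fin d), (∀ i, x i ∈ Set.Ioo (a i) (b i)) →
    σLo ≤ σ x ∧ σ x ≤ σHi

namespace EllipticProblem

variable {d : ℕ} (P : EllipticProblem d)

/-- The open box `Ω`. -/
def Ω : Set (EuclideanSpace ℝ (Fin d)) := {x | ∀ i, x i ∈ Set.Ioo (P.a i) (P.b i)}

/-- Lebesgue measure on `Ω`. -/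
def μ : Measure (EuclideanSpace ℝ (Fin d)) := volume.restrict P.Ω

/-- `α_* = min (ν_*, σ_*)`. -/
def αLo : ℝ := min P.νLo P.σLo

/-- `α^* = max (ν^*, σ^*)`. -/
def αHi : ℝ := max P.νHi P.σHi

end EllipticProblem

/-- Values of a function and of its gradient at a point, with the Euclidean norm. -/
abbrev Jet (𝕜 : Type) [RCLike 𝕜] (d : ℕ) : Type := WithLp 2 (𝕜 × EuclideanSpace 𝕜 (Fin d))

/-- The pair `(ψ x, ∇ψ x)`. -/
def jet {𝕜 : Type} [RCLike 𝕜] {d : ℕ} (ψ : EuclideanSpace ℝ (Fin d) → 𝕜)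
    (x : EuclideanSpace ℝ (Fin d)) : Jet 𝕜 d :=
  WithLp.toLp 2 (ψ x, WithLp.toLp 2 fun i => fderiv ℝ ψ x (EuclideanSpace.single i 1))

namespace EllipticProblem

variable {d : ℕ} (P : EllipticProblem d)

/-- Smooth functions compatible with the boundary condition: `C_c^∞(Ω)` in the Dirichlet case, the
smooth functions on `ℝ^d` with periods `b i - a i` in the periodic case. -/
def IsTestFunction {𝕜 : Type} [RCLike 𝕜] (ψ : EuclideanSpace ℝ (Fin d) → 𝕜) : Prop :=
  ContDiff ℝ ∞ ψ ∧
    match P.bc with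
    | .dirichlet => HasCompactSupport ψ ∧ tsupport ψ ⊆ P.Ω
    | .periodic => ∀ i x, ψ (x + EuclideanSpace.single i (P.b i - P.a i)) = ψ x

/-- The Sobolev space `V = H^1_0(Ω)` or `V = H^1_p(Ω)`: the closure in `H^1(Ω)` of the smooth
functions compatible with the boundary condition. An element `v` is represented by the class in
`L²(Ω)` of `(v, ∇v)`, so that the norm of `V` is `(∫ |v|² + |∇v|²)^{1/2}`. -/
def V (𝕜 : Type) [RCLike 𝕜] : Submodule 𝕜 (Lp (Jet 𝕜 d) 2 P.μ) :=
  (Submodule.span 𝕜 {U : Lp (Jet 𝕜 d) 2 P.μ |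
    ∃ ψ : EuclideanSpace ℝ (Fin d) → 𝕜, P.IsTestFunction ψ ∧ U =ᵐ[P.μ] jet ψ}).topologicalClosure

variable {𝕜 : Type} [RCLike 𝕜]

/-- The sesquilinear form `a(u,v) = ∫ ν ∇u · conj ∇v + ∫ σ u conj v`
(Mathlib's inner product is conjugate linear in its first argument). -/
def form (u v : P.V 𝕜) : 𝕜 :=
  (∫ x, (P.ν x : 𝕜) * inner 𝕜 ((v : Lp (Jet 𝕜 d) 2 P.μ) x).snd ((u : Lp (Jet 𝕜 d) 2 P.μ) x).snd ∂P.μ)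
  + ∫ x, (P.σ x : 𝕜) * inner 𝕜 ((v : Lp (Jet 𝕜 d) 2 P.μ) x).fst ((u : Lp (Jet 𝕜 d) 2 P.μ) x).fst ∂P.μ

/-- The energy norm `√a(v,v)`. -/
def energyNorm (v : P.V 𝕜) : ℝ := √(RCLike.re (P.form v v))

/-- `u ∈ V` solves `a(u,v) = ⟨f,v⟩` for all `v ∈ V`. As `a` is conjugate linear in `v`, the dual
space `V^*` consists of the continuous conjugate linear functionals. -/
def IsWeakSolution (f : P.V 𝕜 →L⋆[𝕜] 𝕜) (u : P.V 𝕜) : Prop :=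
  ∀ v, P.form u v = f v

/-- The residual `r(w) = f - L w`, as a functional on `V`. -/
def residual (f : P.V 𝕜 →L⋆[𝕜] 𝕜) (w : P.V 𝕜) : P.V 𝕜 → 𝕜 :=
  fun v => f v - P.form w v

end EllipticProblem

/-! ### Riesz bases, projections, stiffness matrix -/

/-- The Euclidean distance `|k - ℓ|` of two points of `ℤ^d`. -/
def latticeDist {d : ℕ} (k l : Fin d → ℤ) : ℝ :=
  ‖(WithLp.toLp 2 fun i => ((k i - l i : ℤ) : ℝ) : EuclideanSpace ℝ (Fin d))‖

/-- A Riesz basis `(φ k)` of `V`, indexed by `𝒦 ⊆ ℤ^d`, with weights `d_k > 0`: the map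
`v = ∑ v̂_k φ_k ↦ (v̂_k √d_k)` is an isomorphism of `V` onto `ℓ²(𝒦)`, and
`β_* ‖v‖_V ≤ (∑ |v̂_k|² d_k)^{1/2} ≤ β^* ‖v‖_V`. -/
structure RieszBasis {d : ℕ} (𝕜 : Type) [RCLike 𝕜] (K : Set (Fin d → ℤ)) (V : Type)
    [NormedAddCommGroup V] [NormedSpace 𝕜 V] where
  φ : K → V
  weight : K → ℝ
  weight_pos : ∀ k, 0 < weight k
  repr : V ≃L[𝕜] lp (fun _ : K => 𝕜) 2
  repr_φ : ∀ k, repr (φ k) = lp.single 2 k ((√(weight k) : ℝ) : 𝕜)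
  βLo : ℝ
  βHi : ℝ
  βLo_pos : 0 < βLo
  le_repr : ∀ v, βLo * ‖v‖ ≤ ‖repr v‖
  repr_le : ∀ v, ‖repr v‖ ≤ βHi * ‖v‖

namespace RieszBasis

variable {d : ℕ} {𝕜 : Type} [RCLike 𝕜] {K : Set (Fin d → ℤ)} {V : Type}
  [NormedAddCommGroup V] [NormedSpace 𝕜 V] (B : RieszBasis 𝕜 K V)

/-- The coefficient `v̂_k` of `v = ∑ v̂_k φ_k`. -/
def coeff (v : V) (k : K) : 𝕜 := B.repr v k / ((√(B.weight k) : ℝ) : 𝕜)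

/-- `‖v‖_φ = (∑ |v̂_k|² d_k)^{1/2}`. -/
def phiNorm (v : V) : ℝ := ‖B.repr v‖

/-- The subspace `V_Λ` spanned by the `φ_k`, `k ∈ Λ`. -/
def subspace (Λ : Finset K) : Submodule 𝕜 V := Submodule.span 𝕜 (B.φ '' (Λ : Set K))

/-- The projection `P_Λ v = ∑_{k ∈ Λ} v̂_k φ_k`. -/
def proj (Λ : Finset K) (v : V) : V := ∑ k ∈ Λ, B.coeff v k • B.φ k

/-- The normalized dual coefficients `ĝ_k d_k^{-1/2}`, `ĝ_k = ⟨g, φ_k⟩`, of a functional `g`. -/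
def dualCoeff (g : V → 𝕜) (k : K) : 𝕜 := g (B.φ k) / ((√(B.weight k) : ℝ) : 𝕜)

/-- `‖g‖_{φ^*} = (∑ |ĝ_k|² d_k^{-1})^{1/2}`; the series converges for every `g ∈ V^*`. -/
def dualNorm (g : V → 𝕜) : ℝ := √(∑' k, ‖B.dualCoeff g k‖ ^ 2)

/-- The best `N`-term approximation error `E_N(v) = inf_{|Λ| = N} ‖v - P_Λ v‖_φ`. -/
def bestError (v : V) (N : ℕ) : ℝ :=
  ⨅ Λ : {Λ : Finset K // Λ.card = N}, B.phiNorm (v - B.proj Λ.1 v)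

end RieszBasis

/-- The measure `ω_d` of the Euclidean unit ball of `ℝ^d`. -/
def unitBallVolume (d : ℕ) : ℝ :=
  (volume (Metric.ball (0 : EuclideanSpace ℝ (Fin d)) 1)).toReal

namespace RieszBasis

variable {d : ℕ} {𝕜 : Type} [RCLike 𝕜] {K : Set (Fin d → ℤ)} {V : Type}
  [NormedAddCommGroup V] [NormedSpace 𝕜 V] (B : RieszBasis 𝕜 K V)

/-- `E_N(v) exp(η ω_d^{-t/d} N^{t/d})`. -/
def gevreyTerm (η t : ℝ) (v : V) (N : ℕ) : ℝ :=
  B.bestError v N *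
    Real.exp (η * unitBallVolume d ^ (-(t / (d : ℝ))) * (N : ℝ) ^ (t / (d : ℝ)))

/-- Membership in the Gevrey sparsity class `𝒜_G^{η,t}`. -/
def MemGevrey (η t : ℝ) (v : V) : Prop := BddAbove (Set.range (B.gevreyTerm η t v))

/-- `‖v‖_{𝒜_G^{η,t}} = sup_N E_N(v) exp(η ω_d^{-t/d} N^{t/d})` (for `v` in the class). -/
def gevreyNorm (η t : ℝ) (v : V) : ℝ := ⨆ N, B.gevreyTerm η t v N

end RieszBasis

section Matrices

variable {d : ℕ} {𝕜 : Type} [RCLike 𝕜] {K : Set (Fin d → ℤ)}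

/-- The stiffness matrix with respect to the normalized basis `d_k^{-1/2} φ_k`:
`a_{ℓ,k} = a(φ_k, φ_ℓ) / √(d_ℓ d_k)`. It maps `(v̂_k √d_k)` to `(⟨Lv, φ_ℓ⟩ / √d_ℓ)`. -/
def stiffness (P : EllipticProblem d) (B : RieszBasis 𝕜 K (P.V 𝕜)) (l k : K) : 𝕜 :=
  P.form (B.φ k) (B.φ l) / ((√(B.weight l) * √(B.weight k) : ℝ) : 𝕜)

/-- The class `𝒟_e(η_L)` with constant `c_L`: `|m_{ℓ,k}| ≤ c_L exp(-η_L |ℓ - k|)`. -/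
def ExpDecay (cL ηL : ℝ) (M : K → K → 𝕜) : Prop :=
  ∀ l k : K, ‖M l k‖ ≤ cL * Real.exp (-ηL * latticeDist l.1 k.1)

/-- The bi-infinite matrix `M` has norm at most `C` as an operator on `ℓ²(𝒦)`. -/
def OpNormLE (M : K → K → 𝕜) (C : ℝ) : Prop :=
  ∀ (S : Finset K) (x y : K → 𝕜),
    ‖∑ l ∈ S, ∑ k ∈ S, conj (y l) * M l k * x k‖
      ≤ C * √(∑ k ∈ S, ‖x k‖ ^ 2) * √(∑ l ∈ S, ‖y l‖ ^ 2)

/-- `M'` is the matrix of the inverse on `ℓ²(𝒦)` of the bounded invertible operator with matrix `M`: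
its columns lie in `ℓ²(𝒦)` and `M` maps the `k`-th of them to the `k`-th unit vector. -/
def IsInverseMatrix (M M' : K → K → 𝕜) : Prop :=
  ∀ k, Memℓp (fun l => M' l k) 2 ∧
    ∀ l, HasSum (fun m => M l m * M' m k) (if l = k then 1 else 0)

/-- `M - M_J`, where `M_J` is the symmetric truncation of `M` to the entries with `|ℓ - k| ≤ J`. -/
def truncationError (M : K → K → 𝕜) (J : ℝ) (l k : K) : 𝕜 :=
  if latticeDist l.1 k.1 ≤ J then 0 else M l k

end Matrices

/-! ### The algorithm -/

/-- The parameters of the algorithm: `C₀` of the dynamic marking, and the constants `C_{A⁻¹}`,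
`η̃_L` that describe the decay of the inverse stiffness matrix in the enrichment step. -/
structure Params where
  C₀ : ℝ
  Cinv : ℝ
  ηinv : ℝ

section Algorithm

variable {d : ℕ} {𝕜 : Type} [RCLike 𝕜] {K : Set (Fin d → ℤ)}
  (P : EllipticProblem d) (B : RieszBasis 𝕜 K (P.V 𝕜)) (p : Params)

/-- The parameters are admissible: `0 < C₀ ≤ (1/4) √(α_*/α^*) β_*/β^*`, and
`‖A⁻¹ - (A⁻¹)_J‖ ≤ C_{A⁻¹} exp(-η̃_L J)` for all `J ≥ 0`. -/
structure Params.Admissible : Prop where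
  C₀_pos : 0 < p.C₀
  C₀_le : p.C₀ ≤ 1 / 4 * √(P.αLo / P.αHi) * (B.βLo / B.βHi)
  Cinv_pos : 0 < p.Cinv
  ηinv_pos : 0 < p.ηinv
  inv_decay : ∀ M' : K → K → 𝕜, IsInverseMatrix (stiffness P B) M' → ∀ J : ℝ, 0 ≤ J →
    OpNormLE (truncationError M' J) (p.Cinv * Real.exp (-p.ηinv * J))

/-- The Galerkin solution in `V_Λ`. -/
def IsGalerkin (f : P.V 𝕜 →L⋆[𝕜] 𝕜) (Λ : Finset K) (w : P.V 𝕜) : Prop :=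
  w ∈ B.subspace Λ ∧ ∀ v ∈ B.subspace Λ, P.form w v = f v

/-- The bulk criterion `∑_{k ∈ M} |R̂_k|² ≥ θ² ∑_k |R̂_k|²` for the functional `r`. -/
def BulkCriterion (r : P.V 𝕜 → 𝕜) (θ : ℝ) (M : Finset K) : Prop :=
  θ ^ 2 * B.dualNorm r ^ 2 ≤ ∑ k ∈ M, ‖B.dualCoeff r k‖ ^ 2

/-- A possible output of Dörfler's marking: a set of minimal cardinality with the bulk criterion. -/
def IsDoerfler (r : P.V 𝕜 → 𝕜) (θ : ℝ) (M : Finset K) : Prop :=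
  BulkCriterion P B r θ M ∧ ∀ M' : Finset K, BulkCriterion P B r θ M' → M.card ≤ M'.card

/-- The dynamic marking parameter `θ = (1 - C₀² ‖r‖² / ‖r₀‖²)^{1/2}`, `r₀ = f`. -/
def theta (f : P.V 𝕜 →L⋆[𝕜] 𝕜) (w : P.V 𝕜) : ℝ :=
  √(1 - p.C₀ ^ 2 * B.dualNorm (P.residual f w) ^ 2 / B.dualNorm f ^ 2)

/-- The smallest `J ≥ 0` with `C_{A⁻¹} exp(-η̃_L J) ≤ √((1 - θ²) / (α_* α^*))`. -/
def minRadius (θ : ℝ) : ℝ :=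
  max 0 (-(1 / p.ηinv) * Real.log (√((1 - θ ^ 2) / (P.αLo * P.αHi)) / p.Cinv))

/-- One pass through the loop: from `(Λ, w)`, with `w` the current iterate, to `(Λ', w')`.
The marked set is enriched by all indices at distance at most `J`, where `J` is the smallest
possible radius up to a rounding `δ ∈ [0,1)`, and `w'` is the Galerkin solution in `V_Λ'`. -/
def IsStep (f : P.V 𝕜 →L⋆[𝕜] 𝕜) (Λ : Finset K) (w : P.V 𝕜) (Λ' : Finset K) (w' : P.V 𝕜) : Prop :=
  ∃ (M : Finset K) (δ : ℝ),
    IsDoerfler P B (P.residual f w) (theta P B p f w) M ∧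
    0 ≤ δ ∧ δ < 1 ∧
    (∀ k : K, k ∈ Λ' ↔ k ∈ Λ ∨
      ∃ l ∈ M, latticeDist k.1 l.1 ≤ minRadius P p (theta P B p f w) + δ) ∧
    IsGalerkin P B f Λ' w'

/-- A complete run of DYN-GAL with tolerance `ε`: it starts from `Λ₀ = ∅`, `u₀ = 0`, makes the passes
`0, …, n`, and stops at the first iterate `u_{n+1}`, `n + 1 ≥ 1`, whose residual is at most
`ε ‖r₀‖`. -/
structure IsRun (f : P.V 𝕜 →L⋆[𝕜] 𝕜) (ε : ℝ) (n : ℕ) (Λ : ℕ → Finset K) (w : ℕ → P.V 𝕜) :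
    Prop where
  init_set : Λ 0 = ∅
  init_iterate : w 0 = 0
  step : ∀ k ≤ n, IsStep P B p f (Λ k) (w k) (Λ (k + 1)) (w (k + 1))
  continue_loop : ∀ k < n, ε * B.dualNorm f < B.dualNorm (P.residual f (w (k + 1)))
  terminate : B.dualNorm (P.residual f (w (n + 1))) ≤ ε * B.dualNorm f

end Algorithm

/-! ### Arithmetic cost of linear solvers, workload -/

/-- Operands of an arithmetic operation in the solution of a linear system `M x = g` with index
set `ι`: an entry of `M`, an entry of `g`, a rational constant, or an earlier result. -/
inductive Operand (ι : Type) where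
  | entry (i j : ι)
  | rhs (i : ι)
  | const (q : ℚ)
  | result (n : ℕ)

/-- Arithmetic operations. -/
inductive Instr (ι : Type) where
  | add (x y : Operand ι)
  | sub (x y : Operand ι)
  | mul (x y : Operand ι)
  | div (x y : Operand ι)
  | sqrt (x : Operand ι)
  | conj (x : Operand ι)

/-- A sequence of arithmetic operations, with the places where the solution is found. -/
structure ArithProgram (ι : Type) where
  code : List (Instr ι)
  out : ι → Operand ι

section Cost

variable {𝕜 : Type} [RCLike 𝕜] {ι : Type}

/-- Value of an operand, given the list `mem` of earlier results. -/
def Operand.eval (M : ι → ι → 𝕜) (g : ι → 𝕜) (mem : List 𝕜) : Operand ι → 𝕜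
  | .entry i j => M i j
  | .rhs i => g i
  | .const q => (q : 𝕜)
  | .result n => mem.getD n 0

/-- Result of one operation. -/
def Instr.eval (M : ι → ι → 𝕜) (g : ι → 𝕜) (mem : List 𝕜) : Instr ι → 𝕜
  | .add x y => x.eval M g mem + y.eval M g mem
  | .sub x y => x.eval M g mem - y.eval M g mem
  | .mul x y => x.eval M g mem * y.eval M g mem
  | .div x y => x.eval M g mem / y.eval M g mem
  | .sqrt x => ((√(RCLike.re (x.eval M g mem)) : ℝ) : 𝕜)
  | .conj x => (starRingEnd 𝕜) (x.eval M g mem)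

/-- The results of all operations of a program, in order of execution. -/
def ArithProgram.exec (A : ArithProgram ι) (M : ι → ι → 𝕜) (g : ι → 𝕜) : List 𝕜 :=
  A.code.foldl (fun mem c => mem ++ [c.eval M g mem]) []

/-- The vector computed by a program. -/
def ArithProgram.output (A : ArithProgram ι) (M : ι → ι → 𝕜) (g : ι → 𝕜) (i : ι) : 𝕜 :=
  (A.out i).eval M g (A.exec M g)

/-- The number of arithmetic operations. -/
def ArithProgram.cost (A : ArithProgram ι) : ℕ := A.code.length

end Cost

section Workload

variable {d : ℕ} {𝕜 : Type} [RCLike 𝕜] {K : Set (Fin d → ℤ)}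
  (P : EllipticProblem d) (B : RieszBasis 𝕜 K (P.V 𝕜))

/-- A solver for the Galerkin systems: the sequence of operations that it executes on the system
with index set `Λ` and right-hand side `g`. -/
abbrev Solver (𝕜 : Type) (K : Set (Fin d → ℤ)) : Type :=
  (Λ : Finset K) → (Λ → 𝕜) → ArithProgram Λ

/-- The solver solves all systems `A_Λ x = g`, with at most `C |Λ|` arithmetic operations. -/
def IsLinearCostSolver (s : Solver 𝕜 K) (C : ℝ) : Prop :=
  ∀ (Λ : Finset K) (g : Λ → 𝕜),
    (∀ l : Λ, ∑ k : Λ, stiffness P B l k *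
      (s Λ g).output (fun i j : Λ => stiffness P B i j) g k = g l) ∧
    ((s Λ g).cost : ℝ) ≤ C * Λ.card

/-- The workload of a run with passes `0, …, n`: the work to find (arithmetic operations of the
solver) and to store (one unit per coefficient) each of the iterates `u_1, …, u_{n+1}`. -/
def workload (s : Solver 𝕜 K) (f : P.V 𝕜 →L⋆[𝕜] 𝕜) (n : ℕ) (Λ : ℕ → Finset K) : ℝ :=
  ∑ k ∈ Finset.range (n + 1),
    (((s (Λ (k + 1)) fun l => B.dualCoeff f l).cost : ℝ) + (Λ (k + 1)).card)

end Workload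

end DynGal

end

noncomputable section

namespace DynGal

/-! ### The bilinear form: symmetry, boundedness, coercivity -/

/-! Normalized coefficients turn the problem into an equation in ℓ² for a symmetric operator A
(`stiffnessOp`) with spectrum in [m, M], m = α_*/β^*², M = α^*/β_*². Residual norms become ‖A (U -
W)‖, which is equivalent to the energy norm of the error. With L = log(CS ‖u‖_G / (‖f‖ ε)), it
suffices to bound all quantities by powers of L: t_* only has to make the exponent d/t_* large
enough, and the constants are absorbed into the rates and `CW`.

Passes: the bound on C₀ keeps θ_n² ≥ 1/2, so the bulk criterion and the minimality of Galerkin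
solutions contract the squared energy error by 1 - m/(2M) (`IsSparseStep.energy_le`). Every residual
that enters a pass is at least ε‖f‖, hence there are O(L) passes.

Marked sets: since (1 - θ_n²)‖r_n‖² = (C₀‖r_n‖²/‖f‖)², minimality in Dörfler's marking reduces the
count to exhibiting one small set that carries r_n up to C₀ε²‖f‖. To find it, replace u by a sparse
approximation and the Galerkin solution by Richardson iterates truncated to growing neighbourhoods
of its support (`exists_sparse_approx_residual`). Decay of the stiffness matrix makes the truncation
harmless (`exists_norm_sub_trunc_apply_le`). O(L) sweeps of width O(L) around O(L^(d/t)) indices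
give O(L^(d/t+2d)) indices, uniformly in Λ_n (`exists_sparse_support_residual`).

Total: enrichment costs a factor O(L^d) and summation over the passes a factor O(L), so |Λ| =
O(L^(d/t+3d+1)) (`exists_run_bounds`). Linear-cost solves in all passes cost one more factor L,
which suggests d/t_* = d/t + 3d + 2. -/

theorem integrable_weight_mul_inner {α E 𝕜 : Type*} [RCLike 𝕜] [NormedAddCommGroup E]
    [InnerProductSpace 𝕜 E] [MeasurableSpace α] {μ : Measure α} {f g : α → E} {c : α → ℝ} {C : ℝ}
    (hf : MemLp f 2 μ) (hg : MemLp g 2 μ) (hc : AEMeasurable c μ) (hC : ∀ᵐ x ∂μ, |c x| ≤ C) :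
    Integrable (fun x => (c x : 𝕜) * inner 𝕜 (g x) (f x)) μ := by
  have h := L2.integrable_inner (𝕜 := 𝕜) (hg.toLp g) (hf.toLp f)
  have h' : Integrable (fun x => inner 𝕜 (g x) (f x)) μ := by
    refine h.congr ?_
    filter_upwards [hg.coeFn_toLp, hf.coeFn_toLp] with x h1 h2
    rw [h1, h2]
  refine h'.bdd_mul (c := C) ?_ ?_
  · exact (RCLike.measurable_ofReal.comp_aemeasurable hc).aestronglyMeasurable
  · filter_upwards [hC] with x hx
    simpa using hx

theorem integral_norm_mul_norm_le {α E : Type*} [NormedAddCommGroup E] [MeasurableSpace α]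
    {μ : Measure α} (f g : Lp E 2 μ) : ∫ x, ‖f x‖ * ‖g x‖ ∂μ ≤ ‖f‖ * ‖g‖ := by
  have h := L2.inner_def (𝕜 := ℝ) ((Lp.memLp f).norm.toLp _) ((Lp.memLp g).norm.toLp _)
  have h2 := real_inner_le_norm ((Lp.memLp f).norm.toLp _) ((Lp.memLp g).norm.toLp _)
  rw [h, Lp.norm_toLp, Lp.norm_toLp, eLpNorm_norm, eLpNorm_norm, ← Lp.norm_def, ← Lp.norm_def] at h2
  refine le_trans (le_of_eq (integral_congr_ae ?_)) h2
  filter_upwards [(Lp.memLp f).norm.coeFn_toLp, (Lp.memLp g).norm.coeFn_toLp] with x h1 h2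
  rw [h1, h2]
  simp [mul_comm]

theorem integral_norm_sq_eq {α E : Type*} [NormedAddCommGroup E] [MeasurableSpace α]
    {μ : Measure α} (f : Lp E 2 μ) : ∫ x, ‖f x‖ ^ 2 ∂μ = ‖f‖ ^ 2 := by
  have h := L2.inner_def (𝕜 := ℝ) ((Lp.memLp f).norm.toLp _) ((Lp.memLp f).norm.toLp _)
  rw [real_inner_self_eq_norm_sq, Lp.norm_toLp, eLpNorm_norm, ← Lp.norm_def] at h
  rw [h]
  refine integral_congr_ae ?_
  filter_upwards [(Lp.memLp f).norm.coeFn_toLp] with x h1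
  rw [h1]
  simp

namespace EllipticProblem

variable {d : ℕ} (P : EllipticProblem d) {𝕜 : Type} [RCLike 𝕜]

theorem Ω_measurable : MeasurableSet P.Ω := by
  have : P.Ω = ⋂ i, (fun x : EuclideanSpace ℝ (Fin d) => x i) ⁻¹' Set.Ioo (P.a i) (P.b i) := by
    ext x; simp [Ω]
  rw [this]
  exact MeasurableSet.iInter fun i =>
    measurableSet_Ioo.preimage (EuclideanSpace.proj (𝕜 := ℝ) i).continuous.measurable

theorem αLo_pos : 0 < P.αLo := lt_min P.νLo_pos P.σLo_pos

theorem αLo_le_αHi : P.αLo ≤ P.αHi := by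
  -- The coefficient bounds hold only on the box, so comparing them takes a point of it: the
  -- midpoint.
  have hx : (WithLp.toLp 2 fun i => (P.a i + P.b i) / 2 : EuclideanSpace ℝ (Fin d)) ∈ P.Ω := by
    intro i
    have := P.a_lt_b i
    constructor <;> simp <;> linarith
  have := P.ν_bounds _ hx
  exact (min_le_left _ _).trans ((this.1.trans this.2).trans (le_max_left _ _))

theorem αHi_pos : 0 < P.αHi := P.αLo_pos.trans_le P.αLo_le_αHi

theorem ae_ν : ∀ᵐ x ∂P.μ, P.αLo ≤ P.ν x ∧ P.ν x ≤ P.αHi := by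
  filter_upwards [ae_restrict_mem P.Ω_measurable] with x hx
  exact ⟨(min_le_left _ _).trans (P.ν_bounds x hx).1, (P.ν_bounds x hx).2.trans (le_max_left _ _)⟩

theorem ae_σ : ∀ᵐ x ∂P.μ, P.αLo ≤ P.σ x ∧ P.σ x ≤ P.αHi := by
  filter_upwards [ae_restrict_mem P.Ω_measurable] with x hx
  exact ⟨(min_le_right _ _).trans (P.σ_bounds x hx).1, (P.σ_bounds x hx).2.trans (le_max_right _ _)⟩

theorem memLp_snd (u : Lp (Jet 𝕜 d) 2 P.μ) : MemLp (fun x => (u x).snd) 2 P.μ :=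
  (WithLp.sndL 2 𝕜 𝕜 (EuclideanSpace 𝕜 (Fin d))).comp_memLp' (Lp.memLp u)

theorem memLp_fst (u : Lp (Jet 𝕜 d) 2 P.μ) : MemLp (fun x => (u x).fst) 2 P.μ :=
  (WithLp.fstL 2 𝕜 𝕜 (EuclideanSpace 𝕜 (Fin d))).comp_memLp' (Lp.memLp u)

theorem integrable_gradient_part (u v : Lp (Jet 𝕜 d) 2 P.μ) :
    Integrable (fun x => (P.ν x : 𝕜) * inner 𝕜 (v x).snd (u x).snd) P.μ := by
  refine integrable_weight_mul_inner (C := P.αHi) (P.memLp_snd u) (P.memLp_snd v) P.ν_meas ?_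
  filter_upwards [P.ae_ν] with x hx
  rw [abs_of_pos (P.αLo_pos.trans_le hx.1)]
  exact hx.2

theorem integrable_value_part (u v : Lp (Jet 𝕜 d) 2 P.μ) :
    Integrable (fun x => (P.σ x : 𝕜) * inner 𝕜 (v x).fst (u x).fst) P.μ := by
  refine integrable_weight_mul_inner (C := P.αHi) (P.memLp_fst u) (P.memLp_fst v) P.σ_meas ?_
  filter_upwards [P.ae_σ] with x hx
  rw [abs_of_pos (P.αLo_pos.trans_le hx.1)]
  exact hx.2

theorem form_eq_integral (u v : P.V 𝕜) :
    P.form u v = ∫ x, ((P.ν x : 𝕜) * inner 𝕜 ((v : Lp (Jet 𝕜 d) 2 P.μ) x).snd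
        ((u : Lp (Jet 𝕜 d) 2 P.μ) x).snd
      + (P.σ x : 𝕜) * inner 𝕜 ((v : Lp (Jet 𝕜 d) 2 P.μ) x).fst
        ((u : Lp (Jet 𝕜 d) 2 P.μ) x).fst) ∂P.μ :=
  (integral_add (P.integrable_gradient_part _ _) (P.integrable_value_part _ _)).symm

theorem conj_form (u v : P.V 𝕜) : conj (P.form u v) = P.form v u := by
  simp only [form_eq_integral, ← integral_conj, map_add, map_mul, RCLike.conj_ofReal,
    inner_conj_symm]

theorem form_add_left (u u' v : P.V 𝕜) : P.form (u + u') v = P.form u v + P.form u' v := by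
  simp only [form_eq_integral]
  rw [← integral_add ((P.integrable_gradient_part _ _).add (P.integrable_value_part _ _))
    ((P.integrable_gradient_part _ _).add (P.integrable_value_part _ _))]
  refine integral_congr_ae ?_
  filter_upwards [Lp.coeFn_add (u : Lp (Jet 𝕜 d) 2 P.μ) u'] with x hx
  simp only [Submodule.coe_add, hx, Pi.add_apply, WithLp.add_fst, WithLp.add_snd, inner_add_right]
  ring

theorem form_smul_left (c : 𝕜) (u v : P.V 𝕜) : P.form (c • u) v = c * P.form u v := by
  simp only [form_eq_integral]
  rw [← integral_const_mul]
  refine integral_congr_ae ?_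
  filter_upwards [Lp.coeFn_smul c (u : Lp (Jet 𝕜 d) 2 P.μ)] with x hx
  simp only [Submodule.coe_smul, hx, Pi.smul_apply, WithLp.smul_fst, WithLp.smul_snd,
    inner_smul_right]
  ring

theorem form_add_right (u v v' : P.V 𝕜) : P.form u (v + v') = P.form u v + P.form u v' := by
  rw [← P.conj_form, form_add_left, map_add, P.conj_form, P.conj_form]

theorem form_smul_right (c : 𝕜) (u v : P.V 𝕜) : P.form u (c • v) = conj c * P.form u v := by
  rw [← P.conj_form, form_smul_left, map_mul, P.conj_form]

theorem form_sub_left (u u' v : P.V 𝕜) : P.form (u - u') v = P.form u v - P.form u' v := by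
  have := P.form_add_left (u - u') u' v
  rw [sub_add_cancel] at this
  rw [this, add_sub_cancel_right]

theorem norm_form_le (u v : P.V 𝕜) : ‖P.form u v‖ ≤ P.αHi * ‖u‖ * ‖v‖ := by
  rw [form_eq_integral, mul_assoc]
  have h := integral_norm_mul_norm_le (u : Lp (Jet 𝕜 d) 2 P.μ) v
  refine le_trans ?_ (mul_le_mul_of_nonneg_left h P.αHi_pos.le)
  rw [← integral_const_mul]
  refine norm_integral_le_of_norm_le ?_ ?_
  · refine Integrable.const_mul ?_ _
    exact (Lp.memLp (u : Lp (Jet 𝕜 d) 2 P.μ)).norm.integrable_mul (Lp.memLp _).norm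
  filter_upwards [P.ae_ν, P.ae_σ] with x hν hσ
  set U := (u : Lp (Jet 𝕜 d) 2 P.μ) x
  set W := (v : Lp (Jet 𝕜 d) 2 P.μ) x
  have h1 : ‖inner 𝕜 W.snd U.snd‖ ≤ ‖W.snd‖ * ‖U.snd‖ := norm_inner_le_norm _ _
  have h2 : ‖inner 𝕜 W.fst U.fst‖ ≤ ‖W.fst‖ * ‖U.fst‖ := norm_inner_le_norm _ _
  have hp := P.αLo_pos
  -- Cauchy–Schwarz in ℝ² joins gradient and value, so that the constant stays `αHi` without a
  -- factor 2.
  have h3 : ‖W.snd‖ * ‖U.snd‖ + ‖W.fst‖ * ‖U.fst‖ ≤ ‖U‖ * ‖W‖ := by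
    refine abs_le_of_sq_le_sq' ?_ (by positivity) |>.2
    rw [mul_pow, WithLp.prod_norm_sq_eq_of_L2, WithLp.prod_norm_sq_eq_of_L2]
    nlinarith [sq_nonneg (‖W.snd‖ * ‖U.fst‖ - ‖W.fst‖ * ‖U.snd‖)]
  calc _ ≤ ‖(P.ν x : 𝕜) * inner 𝕜 W.snd U.snd‖ + ‖(P.σ x : 𝕜) * inner 𝕜 W.fst U.fst‖ :=
        norm_add_le _ _
    _ = P.ν x * ‖inner 𝕜 W.snd U.snd‖ + P.σ x * ‖inner 𝕜 W.fst U.fst‖ := by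
        rw [norm_mul, norm_mul, RCLike.norm_ofReal, RCLike.norm_ofReal,
          abs_of_pos (hp.trans_le hν.1), abs_of_pos (hp.trans_le hσ.1)]
    _ ≤ P.αHi * (‖W.snd‖ * ‖U.snd‖) + P.αHi * (‖W.fst‖ * ‖U.fst‖) := by
        have := P.αHi_pos
        gcongr
        exacts [hν.2, hσ.2]
    _ ≤ _ := by
        rw [← mul_add]
        exact mul_le_mul_of_nonneg_left h3 P.αHi_pos.le

theorem re_form_self_bounds (v : P.V 𝕜) :
    P.αLo * ‖v‖ ^ 2 ≤ RCLike.re (P.form v v) ∧ RCLike.re (P.form v v) ≤ P.αHi * ‖v‖ ^ 2 := by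
  have hI := (P.integrable_gradient_part (v : Lp (Jet 𝕜 d) 2 P.μ) v).add
    (P.integrable_value_part (v : Lp (Jet 𝕜 d) 2 P.μ) v)
  have hsq : Integrable (fun x => ‖(v : Lp (Jet 𝕜 d) 2 P.μ) x‖ ^ 2) P.μ :=
    (Lp.memLp (v : Lp (Jet 𝕜 d) 2 P.μ)).norm.integrable_sq
  have key : ∀ x, RCLike.re ((P.ν x : 𝕜) * inner 𝕜 ((v : Lp (Jet 𝕜 d) 2 P.μ) x).snd
        ((v : Lp (Jet 𝕜 d) 2 P.μ) x).snd
      + (P.σ x : 𝕜) * inner 𝕜 ((v : Lp (Jet 𝕜 d) 2 P.μ) x).fst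
        ((v : Lp (Jet 𝕜 d) 2 P.μ) x).fst) =
      P.ν x * ‖((v : Lp (Jet 𝕜 d) 2 P.μ) x).snd‖ ^ 2
        + P.σ x * ‖((v : Lp (Jet 𝕜 d) 2 P.μ) x).fst‖ ^ 2 := by
    intro x
    rw [map_add, RCLike.re_ofReal_mul, RCLike.re_ofReal_mul, inner_self_eq_norm_sq,
      inner_self_eq_norm_sq]
  have hre : RCLike.re (P.form v v) = ∫ x, (P.ν x * ‖((v : Lp (Jet 𝕜 d) 2 P.μ) x).snd‖ ^ 2
        + P.σ x * ‖((v : Lp (Jet 𝕜 d) 2 P.μ) x).fst‖ ^ 2) ∂P.μ := by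
    rw [form_eq_integral]
    exact (integral_re hI).symm.trans (integral_congr_ae (Filter.Eventually.of_forall key))
  have hI' : Integrable (fun x => P.ν x * ‖((v : Lp (Jet 𝕜 d) 2 P.μ) x).snd‖ ^ 2
        + P.σ x * ‖((v : Lp (Jet 𝕜 d) 2 P.μ) x).fst‖ ^ 2) P.μ :=
    hI.re.congr (Filter.Eventually.of_forall key)
  have hn : ‖v‖ ^ 2 = ∫ x, ‖(v : Lp (Jet 𝕜 d) 2 P.μ) x‖ ^ 2 ∂P.μ :=
    (integral_norm_sq_eq (v : Lp (Jet 𝕜 d) 2 P.μ)).symm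
  rw [hre, hn, ← integral_const_mul, ← integral_const_mul]
  constructor
  · refine integral_mono_ae (hsq.const_mul _) hI' ?_
    filter_upwards [P.ae_ν, P.ae_σ] with x hν hσ
    simp only [WithLp.prod_norm_sq_eq_of_L2]
    have := mul_le_mul_of_nonneg_right hν.1 (sq_nonneg ‖((v : Lp (Jet 𝕜 d) 2 P.μ) x).snd‖)
    have := mul_le_mul_of_nonneg_right hσ.1 (sq_nonneg ‖((v : Lp (Jet 𝕜 d) 2 P.μ) x).fst‖)
    linarith
  · refine integral_mono_ae hI' (hsq.const_mul _) ?_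
    filter_upwards [P.ae_ν, P.ae_σ] with x hν hσ
    simp only [WithLp.prod_norm_sq_eq_of_L2]
    have := mul_le_mul_of_nonneg_right hν.2 (sq_nonneg ‖((v : Lp (Jet 𝕜 d) 2 P.μ) x).snd‖)
    have := mul_le_mul_of_nonneg_right hσ.2 (sq_nonneg ‖((v : Lp (Jet 𝕜 d) 2 P.μ) x).fst‖)
    linarith

end EllipticProblem

/-! ### Truncation of square summable sequences -/

section Truncation

variable {ι 𝕜 : Type} [RCLike 𝕜] [DecidableEq ι]

/-- The restriction of a square summable sequence to a finite set of indices. -/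
def trunc (S : Finset ι) (x : lp (fun _ : ι => 𝕜) 2) : lp (fun _ : ι => 𝕜) 2 :=
  ∑ k ∈ S, lp.single 2 k (x k)

theorem trunc_apply (S : Finset ι) (x : lp (fun _ : ι => 𝕜) 2) (k : ι) :
    trunc S x k = if k ∈ S then x k else 0 := by
  simp only [trunc, lp.coeFn_sum, Finset.sum_apply, lp.coeFn_single, Finset.sum_pi_single]

theorem trunc_add (S : Finset ι) (x y : lp (fun _ : ι => 𝕜) 2) :
    trunc S (x + y) = trunc S x + trunc S y := by
  ext k
  simp only [trunc_apply, lp.coeFn_add, Pi.add_apply]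
  split_ifs <;> simp

theorem trunc_sub (S : Finset ι) (x y : lp (fun _ : ι => 𝕜) 2) :
    trunc S (x - y) = trunc S x - trunc S y := by
  ext k
  simp only [trunc_apply, lp.coeFn_sub, Pi.sub_apply]
  split_ifs <;> simp

theorem trunc_smul (S : Finset ι) (c : 𝕜) (x : lp (fun _ : ι => 𝕜) 2) :
    trunc S (c • x) = c • trunc S x := by
  ext k
  simp only [trunc_apply, lp.coeFn_smul, Pi.smul_apply]
  split_ifs <;> simp

theorem trunc_zero (S : Finset ι) : trunc S (0 : lp (fun _ : ι => 𝕜) 2) = 0 := by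
  ext k
  simp [trunc_apply]

theorem trunc_trunc_of_subset {S T : Finset ι} (h : S ⊆ T) (x : lp (fun _ : ι => 𝕜) 2) :
    trunc T (trunc S x) = trunc S x := by
  ext k
  simp only [trunc_apply]
  by_cases hk : k ∈ S
  · simp [hk, h hk]
  · simp [hk]

theorem trunc_comm (S T : Finset ι) (x : lp (fun _ : ι => 𝕜) 2) :
    trunc S (trunc T x) = trunc T (trunc S x) := by
  ext k
  simp only [trunc_apply]
  split_ifs <;> rfl

theorem trunc_eq_self_of_subset {S T : Finset ι} (h : S ⊆ T) {x : lp (fun _ : ι => 𝕜) 2}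
    (hx : trunc S x = x) : trunc T x = x := by
  rw [← hx, trunc_trunc_of_subset h]

theorem inner_trunc (S : Finset ι) (x y : lp (fun _ : ι => 𝕜) 2) :
    inner 𝕜 (trunc S x) y = inner 𝕜 x (trunc S y) := by
  rw [lp.inner_eq_tsum, lp.inner_eq_tsum]
  refine tsum_congr fun k => ?_
  simp only [trunc_apply]
  split_ifs <;> simp

theorem norm_sq_trunc (S : Finset ι) (x : lp (fun _ : ι => 𝕜) 2) :
    ‖trunc S x‖ ^ 2 = ∑ k ∈ S, ‖x k‖ ^ 2 := by
  have h := lp.norm_sum_single (E := fun _ : ι => 𝕜) (p := 2) (by norm_num) (fun k => x k) S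
  simpa [trunc] using h

theorem norm_sq_eq_trunc_add (S : Finset ι) (x : lp (fun _ : ι => 𝕜) 2) :
    ‖x‖ ^ 2 = ‖trunc S x‖ ^ 2 + ‖x - trunc S x‖ ^ 2 := by
  have h : inner 𝕜 (trunc S x) (x - trunc S x) = 0 := by
    rw [inner_trunc, trunc_sub, trunc_trunc_of_subset (le_refl S), sub_self, inner_zero_right]
  have := norm_add_sq_eq_norm_sq_add_norm_sq_of_inner_eq_zero (trunc S x) (x - trunc S x) h
  rw [add_sub_cancel] at this
  simpa [sq] using this

theorem norm_trunc_le (S : Finset ι) (x : lp (fun _ : ι => 𝕜) 2) : ‖trunc S x‖ ≤ ‖x‖ := by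
  refine abs_le_of_sq_le_sq' ?_ (norm_nonneg _) |>.2
  rw [norm_sq_eq_trunc_add S x]
  exact le_add_of_nonneg_right (sq_nonneg _)

theorem norm_sub_trunc_le (S : Finset ι) (x : lp (fun _ : ι => 𝕜) 2) :
    ‖x - trunc S x‖ ≤ ‖x‖ := by
  refine abs_le_of_sq_le_sq' ?_ (norm_nonneg _) |>.2
  rw [norm_sq_eq_trunc_add S x]
  exact le_add_of_nonneg_left (sq_nonneg _)

/-- Truncation is the best approximation supported in S: x and x - y have the same part outside S.
-/
theorem norm_sub_trunc_le_norm_sub (S : Finset ι) (x : lp (fun _ : ι => 𝕜) 2)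
    {y : lp (fun _ : ι => 𝕜) 2} (hy : trunc S y = y) : ‖x - trunc S x‖ ≤ ‖x - y‖ := by
  have h := norm_sub_trunc_le S (x - y)
  rwa [trunc_sub, hy, sub_sub_sub_cancel_right] at h

end Truncation

/-! ### Elliptic operators on a Hilbert space -/

section Elliptic

variable {𝕜 E : Type*} [RCLike 𝕜] [NormedAddCommGroup E] [InnerProductSpace 𝕜 E]

/-- A symmetric operator with spectrum in `[m, M]`, `0 < m ≤ M`. -/
structure IsElliptic (A : E →L[𝕜] E) (m M : ℝ) : Prop where
  symm : ∀ x y, inner 𝕜 (A x) y = inner 𝕜 x (A y)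
  m_pos : 0 < m
  m_le_M : m ≤ M
  lower : ∀ x, m * ‖x‖ ^ 2 ≤ RCLike.re (inner 𝕜 x (A x))
  upper : ∀ x, RCLike.re (inner 𝕜 x (A x)) ≤ M * ‖x‖ ^ 2

/-- The square of the energy norm. -/
def energy (A : E →L[𝕜] E) (x : E) : ℝ := RCLike.re (inner 𝕜 x (A x))

theorem energy_le_norm_mul (A : E →L[𝕜] E) (x : E) : energy A x ≤ ‖x‖ * ‖A x‖ :=
  (RCLike.re_le_norm _).trans (norm_inner_le_norm _ _)

namespace IsElliptic

variable {A : E →L[𝕜] E} {m M : ℝ}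

theorem M_pos (h : IsElliptic A m M) : 0 < M := h.m_pos.trans_le h.m_le_M

theorem energy_nonneg (h : IsElliptic A m M) (x : E) : 0 ≤ energy A x :=
  (mul_nonneg h.m_pos.le (sq_nonneg _)).trans (h.lower x)

theorem energy_sub (h : IsElliptic A m M) (x y : E) :
    energy A (x - y) = energy A x - 2 * RCLike.re (inner 𝕜 y (A x)) + energy A y := by
  have : RCLike.re (inner 𝕜 x (A y)) = RCLike.re (inner 𝕜 y (A x)) := by
    rw [← h.symm, ← inner_conj_symm, RCLike.conj_re]
  simp only [energy, map_sub, inner_sub_left, inner_sub_right, this]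
  ring

theorem energy_add (h : IsElliptic A m M) (x y : E) :
    energy A (x + y) = energy A x + 2 * RCLike.re (inner 𝕜 y (A x)) + energy A y := by
  have := h.energy_sub (x + y) y
  rw [add_sub_cancel_right, map_add, inner_add_right, map_add] at this
  simp only [energy] at this ⊢
  linarith

/-- A gradient step with step size `1 / M` in a direction `z` in which the residual `A x` has the
component `‖z‖²` lowers the energy by `‖z‖² / M`. -/
theorem energy_sub_smul_le (h : IsElliptic A m M) (x z : E)
    (hz : RCLike.re (inner 𝕜 z (A x)) = ‖z‖ ^ 2) :
    energy A (x - ((M⁻¹ : ℝ) : 𝕜) • z) ≤ energy A x - ‖z‖ ^ 2 / M := by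
  have hM := h.M_pos
  have h1 := h.upper (((M⁻¹ : ℝ) : 𝕜) • z)
  rw [h.energy_sub, inner_smul_left, RCLike.conj_ofReal, RCLike.re_ofReal_mul, hz]
  rw [norm_smul, RCLike.norm_ofReal, abs_of_pos (inv_pos.2 hM)] at h1
  have h2 : M * (M⁻¹ * ‖z‖) ^ 2 = ‖z‖ ^ 2 / M := by field_simp
  have h3 : M⁻¹ * ‖z‖ ^ 2 = ‖z‖ ^ 2 / M := by field_simp
  rw [h2] at h1
  rw [h3]
  change _ + RCLike.re _ ≤ _
  linarith

/-- The full gradient step z = A x leaves a nonnegative energy. This avoids square roots of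
operators. -/
theorem norm_apply_sq_le (h : IsElliptic A m M) (x : E) : ‖A x‖ ^ 2 ≤ M * energy A x := by
  have h1 := h.energy_sub_smul_le x (A x) (inner_self_eq_norm_sq (𝕜 := 𝕜) _)
  have h2 := h.energy_nonneg (x - ((M⁻¹ : ℝ) : 𝕜) • A x)
  have h3 : ‖A x‖ ^ 2 / M ≤ energy A x := by linarith
  rw [div_le_iff₀ h.M_pos] at h3
  linarith

theorem norm_apply_le (h : IsElliptic A m M) (x : E) : ‖A x‖ ≤ M * ‖x‖ := by
  refine abs_le_of_sq_le_sq' ?_ (mul_nonneg h.M_pos.le (norm_nonneg _)) |>.2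
  have h1 := mul_le_mul_of_nonneg_left (h.upper x) h.M_pos.le
  have h2 := h.norm_apply_sq_le x
  rw [energy] at h2
  nlinarith

theorem norm_le_apply (h : IsElliptic A m M) (x : E) : m * ‖x‖ ≤ ‖A x‖ := by
  have h1 := (h.lower x).trans (energy_le_norm_mul A x)
  rcases (norm_nonneg x).eq_or_lt with h0 | h0
  · rw [← h0]; simp
  · nlinarith

/-- Together with `norm_apply_sq_le`, this makes the residual a two-sided estimator of the energy
error. -/
theorem mul_energy_le (h : IsElliptic A m M) (x : E) : m * energy A x ≤ ‖A x‖ ^ 2 := by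
  have h1 := energy_le_norm_mul A x
  have h2 := h.norm_le_apply x
  have := h.m_pos
  nlinarith [norm_nonneg (A x)]

/-- The Richardson iteration is a contraction. -/
theorem norm_sub_smul_sq_le (h : IsElliptic A m M) (x z : E)
    (hz : RCLike.re (inner 𝕜 x z) = energy A x) (hz' : ‖z‖ ≤ ‖A x‖) :
    ‖x - ((M⁻¹ : ℝ) : 𝕜) • z‖ ^ 2 ≤ (1 - m / M) * ‖x‖ ^ 2 := by
  have hM := h.M_pos
  have h1 := h.norm_apply_sq_le x
  have h2 : ‖z‖ ^ 2 ≤ M * energy A x := le_trans (by gcongr) h1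
  rw [@norm_sub_sq 𝕜, inner_smul_right, RCLike.re_ofReal_mul, hz, norm_smul, RCLike.norm_ofReal,
    abs_of_pos (inv_pos.2 hM), mul_pow]
  have h3 : M⁻¹ ^ 2 * ‖z‖ ^ 2 ≤ M⁻¹ ^ 2 * (M * energy A x) := by gcongr
  have h4 : M⁻¹ ^ 2 * (M * energy A x) = M⁻¹ * energy A x := by field_simp
  have h5 : M⁻¹ * (m * ‖x‖ ^ 2) ≤ M⁻¹ * energy A x := by
    have := h.lower x
    exact mul_le_mul_of_nonneg_left this (inv_pos.2 hM).le
  have h6 : m / M * ‖x‖ ^ 2 = M⁻¹ * (m * ‖x‖ ^ 2) := by field_simp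
  linarith

end IsElliptic

end Elliptic

/-! ### Galerkin approximations in `ℓ²` -/

section Galerkin

variable {ι 𝕜 : Type} [RCLike 𝕜] [DecidableEq ι]
  {A : lp (fun _ : ι => 𝕜) 2 →L[𝕜] lp (fun _ : ι => 𝕜) 2} {m M : ℝ}

/-- `W` is the Galerkin approximation to `U` with support in `Λ`. -/
structure IsGalerkinSeq (A : lp (fun _ : ι => 𝕜) 2 →L[𝕜] lp (fun _ : ι => 𝕜) 2)
    (Λ : Finset ι) (U W : lp (fun _ : ι => 𝕜) 2) : Prop where
  supp : trunc Λ W = W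
  orth : trunc Λ (A (U - W)) = 0

/-- Pythagoras in the energy inner product: the residual is orthogonal to everything supported in Λ.
-/
theorem IsGalerkinSeq.energy_le (hA : IsElliptic A m M) {Λ : Finset ι}
    {U W z : lp (fun _ : ι => 𝕜) 2} (hW : IsGalerkinSeq A Λ U W) (hz : trunc Λ z = z) :
    energy A (U - W) ≤ energy A (U - z) := by
  have h1 : U - z = (U - W) + (W - z) := by abel
  have h2 : trunc Λ (W - z) = W - z := by rw [trunc_sub, hW.supp, hz]
  rw [h1, hA.energy_add, ← h2, inner_trunc, hW.orth, inner_zero_right, map_zero]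
  have := hA.energy_nonneg (trunc Λ (W - z))
  linarith

/-- The competitor W + M⁻¹ · (residual on S) is supported in Λ, and this gradient step already gains
ρ‖A (U - W)‖²/M ≥ ρ (m/M) · energy. -/
theorem IsGalerkinSeq.energy_le_mul (hA : IsElliptic A m M) {Λ S : Finset ι}
    {U W W' : lp (fun _ : ι => 𝕜) 2} (hW' : IsGalerkinSeq A Λ U W') (hW : trunc Λ W = W)
    (hS : S ⊆ Λ) {ρ : ℝ} (hρ : 0 ≤ ρ)
    (hbulk : ρ * ‖A (U - W)‖ ^ 2 ≤ ‖trunc S (A (U - W))‖ ^ 2) :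
    energy A (U - W') ≤ (1 - ρ * (m / M)) * energy A (U - W) := by
  have hM := hA.M_pos
  set R := A (U - W)
  have h1 : trunc Λ (W + ((M⁻¹ : ℝ) : 𝕜) • trunc S R) = W + ((M⁻¹ : ℝ) : 𝕜) • trunc S R := by
    rw [trunc_add, hW, trunc_smul, trunc_trunc_of_subset hS]
  have h2 := hW'.energy_le hA h1
  rw [← sub_sub] at h2
  have h3 := hA.energy_sub_smul_le (U - W) (trunc S R) (by
    have : inner 𝕜 (trunc S R) (trunc S R) = inner 𝕜 (trunc S R) R := by
      rw [← inner_trunc, trunc_trunc_of_subset (le_refl S)]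
    rw [← inner_self_eq_norm_sq (𝕜 := 𝕜) (trunc S R), this])
  have h4 : ρ * (m * energy A (U - W)) ≤ ρ * ‖R‖ ^ 2 := by
    gcongr
    exact hA.mul_energy_le _
  have h5 : ρ * (m / M) * energy A (U - W) = ρ * (m * energy A (U - W)) / M := by ring
  have h6 : ρ * (m * energy A (U - W)) / M ≤ ‖trunc S R‖ ^ 2 / M := by
    gcongr
    exact h4.trans hbulk
  linarith

theorem IsGalerkinSeq.norm_sub_le (hA : IsElliptic A m M) {Λ : Finset ι}
    {U W : lp (fun _ : ι => 𝕜) 2} (hW : IsGalerkinSeq A Λ U W) : ‖U - W‖ ≤ M / m * ‖U‖ := by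
  have hm := hA.m_pos
  have hM := hA.M_pos
  have h1 := hW.energy_le hA (trunc_zero Λ)
  rw [sub_zero] at h1
  have h2 := (hA.lower (U - W)).trans (h1.trans (hA.upper U))
  refine abs_le_of_sq_le_sq' ?_ (by positivity) |>.2
  have h3 : ‖U - W‖ ^ 2 ≤ M / m * ‖U‖ ^ 2 := by
    rw [div_mul_eq_mul_div, le_div_iff₀ hm]; linarith
  -- The square root of M/m is given away: M/m ≤ (M/m)².
  have h4 : 1 ≤ M / m := (one_le_div hm).2 hA.m_le_M
  rw [mul_pow]
  refine h3.trans ?_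
  gcongr
  nlinarith

end Galerkin

/-! ### Sparse approximation of the residual of a Galerkin approximation -/

theorem le_geometric_of_affine_recurrence {x : ℕ → ℝ} {q b : ℝ} (hq : 0 ≤ q) (hq1 : q < 1)
    (hb : 0 ≤ b) (h : ∀ j, x (j + 1) ≤ q * x j + b) (n : ℕ) :
    x n ≤ q ^ n * x 0 + b / (1 - q) := by
  have h1 : 0 < 1 - q := by linarith
  induction n with
  | zero => simpa using div_nonneg hb h1.le
  | succ n ih =>
    have h2 : b / (1 - q) = q * (b / (1 - q)) + b := by field_simp; ring
    calc x (n + 1) ≤ q * x n + b := h n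
      _ ≤ q * (q ^ n * x 0 + b / (1 - q)) + b := by gcongr
      _ = q ^ (n + 1) * x 0 + (q * (b / (1 - q)) + b) := by ring
      _ = _ := by rw [← h2]

section Residual

variable {ι 𝕜 : Type} [RCLike 𝕜] [DecidableEq ι]
  {A : lp (fun _ : ι => 𝕜) 2 →L[𝕜] lp (fun _ : ι => 𝕜) 2} {m M : ℝ}

/-- Richardson's iteration for the Galerkin system with index set `Λ`, with the right-hand side
`A V` and with the `j`-th iterate truncated to `S j`. -/
def sparseRichardson (A : lp (fun _ : ι => 𝕜) 2 →L[𝕜] lp (fun _ : ι => 𝕜) 2) (M : ℝ)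
    (Λ : Finset ι) (S : ℕ → Finset ι) (V : lp (fun _ : ι => 𝕜) 2) : ℕ → lp (fun _ : ι => 𝕜) 2
  | 0 => 0
  | j + 1 => trunc (S (j + 1)) (sparseRichardson A M Λ S V j +
      ((M⁻¹ : ℝ) : 𝕜) • trunc Λ (A (V - sparseRichardson A M Λ S V j)))

theorem trunc_sparseRichardson (Λ : Finset ι) (S : ℕ → Finset ι) (V : lp (fun _ : ι => 𝕜) 2)
    (j : ℕ) : trunc (S j) (sparseRichardson A M Λ S V j) = sparseRichardson A M Λ S V j := by
  cases j with
  | zero => exact trunc_zero _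
  | succ j => exact trunc_trunc_of_subset (le_refl _) _

theorem trunc_galerkin_sparseRichardson (Λ : Finset ι) (S : ℕ → Finset ι)
    (V : lp (fun _ : ι => 𝕜) 2) (j : ℕ) :
    trunc Λ (sparseRichardson A M Λ S V j) = sparseRichardson A M Λ S V j := by
  induction j with
  | zero => exact trunc_zero _
  | succ j ih =>
    rw [sparseRichardson, trunc_comm, trunc_add, ih, trunc_smul, trunc_trunc_of_subset (le_refl _)]

/-- The new error has three sources: an exact Richardson step for the Galerkin system, which
contracts; the replacement of U by V on the right-hand side; and the truncation to `S (j + 1)`.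
Galerkin orthogonality removes A (U - W), and the truncations to Λ and to `S (j + 1)` commute. -/
theorem norm_sub_sparseRichardson_succ_le (hA : IsElliptic A m M) {Λ : Finset ι}
    {U W V : lp (fun _ : ι => 𝕜) 2} (hW : IsGalerkinSeq A Λ U W) {S : ℕ → Finset ι}
    (hS : ∀ j, S j ⊆ S (j + 1)) {γ : ℝ}
    (hγ : ∀ j v, trunc (S j) v = v → ‖A v - trunc (S (j + 1)) (A v)‖ ≤ γ * ‖v‖)
    (hV : trunc (S 0) V = V) (j : ℕ) :
    ‖W - sparseRichardson A M Λ S V (j + 1)‖ ≤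
      √(1 - m / M) * ‖W - sparseRichardson A M Λ S V j‖ + ‖U - V‖
        + M⁻¹ * (γ * ‖V - sparseRichardson A M Λ S V j‖) := by
  have hM := hA.M_pos
  set x := sparseRichardson A M Λ S V j with hx
  set c : 𝕜 := ((M⁻¹ : ℝ) : 𝕜) with hc
  have hcn : ‖c‖ = M⁻¹ := by rw [hc, RCLike.norm_ofReal, abs_of_pos (inv_pos.2 hM)]
  have hVj : trunc (S j) V = V := by
    refine trunc_eq_self_of_subset ?_ hV
    exact monotone_nat_of_le_succ hS (Nat.zero_le j)
  have hxj : trunc (S j) x = x := trunc_sparseRichardson Λ S V j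
  have hxΛ : trunc Λ x = x := trunc_galerkin_sparseRichardson Λ S V j
  have hxj' : trunc (S (j + 1)) x = x := trunc_eq_self_of_subset (hS j) hxj
  have e1 : W - sparseRichardson A M Λ S V (j + 1) =
      ((W - x) - c • trunc Λ (A (W - x))) + c • trunc Λ (A (U - V))
        + c • trunc Λ (A (V - x) - trunc (S (j + 1)) (A (V - x))) := by
    have h1 : A (V - x) = A (W - x) + A (U - W) - A (U - V) := by
      rw [← map_add, ← map_sub]; congr 1; abel
    have h2 : trunc Λ (A (V - x)) = trunc Λ (A (W - x)) - trunc Λ (A (U - V)) := by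
      rw [h1, trunc_sub, trunc_add, hW.orth, add_zero]
    have h3 : trunc (S (j + 1)) (trunc Λ (A (V - x))) = trunc Λ (trunc (S (j + 1)) (A (V - x))) :=
      trunc_comm _ _ _
    rw [sparseRichardson, ← hx, trunc_add, hxj', trunc_smul, ← hc, trunc_sub, ← h3, smul_sub, h2,
      smul_sub]
    abel
  have h2 : ‖(W - x) - c • trunc Λ (A (W - x))‖ ≤ √(1 - m / M) * ‖W - x‖ := by
    have hs : trunc Λ (W - x) = W - x := by rw [trunc_sub, hW.supp, hxΛ]
    have := hA.norm_sub_smul_sq_le (W - x) (trunc Λ (A (W - x)))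
      (by rw [← inner_trunc, hs]; rfl) (norm_trunc_le _ _)
    have hn := Real.sqrt_le_sqrt this
    rw [Real.sqrt_sq (norm_nonneg _)] at hn
    refine hn.trans (le_of_eq ?_)
    have h0 : 0 ≤ 1 - m / M := by
      rw [sub_nonneg, div_le_one hM]; exact hA.m_le_M
    rw [Real.sqrt_mul h0, Real.sqrt_sq (norm_nonneg _)]
  have h3 : ‖c • trunc Λ (A (U - V))‖ ≤ ‖U - V‖ := by
    rw [norm_smul, hcn]
    calc M⁻¹ * ‖trunc Λ (A (U - V))‖ ≤ M⁻¹ * (M * ‖U - V‖) := by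
          gcongr
          exact (norm_trunc_le _ _).trans (hA.norm_apply_le _)
      _ = ‖U - V‖ := by field_simp
  have h4 : ‖c • trunc Λ (A (V - x) - trunc (S (j + 1)) (A (V - x)))‖
      ≤ M⁻¹ * (γ * ‖V - x‖) := by
    rw [norm_smul, hcn]
    gcongr
    exact (norm_trunc_le _ _).trans (hγ j _ (by rw [trunc_sub, hVj, hxj]))
  rw [e1]
  refine (norm_add_le _ _).trans (add_le_add ((norm_add_le _ _).trans (add_le_add h2 h3)) h4)

/-- The residual of a Galerkin approximation is approximated, uniformly in the index set `Λ`, by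
sequences with supports that grow with the accuracy only. -/
theorem exists_sparse_approx_residual (hA : IsElliptic A m M) :
    ∃ C q γ₀ : ℝ, 0 < C ∧ 0 < q ∧ q < 1 ∧ 0 < γ₀ ∧
      ∀ (Λ : Finset ι) (U W : lp (fun _ : ι => 𝕜) 2), IsGalerkinSeq A Λ U W →
      ∀ S : ℕ → Finset ι, (∀ j, S j ⊆ S (j + 1)) → ∀ γ : ℝ, 0 ≤ γ → γ ≤ γ₀ →
      (∀ j v, trunc (S j) v = v → ‖A v - trunc (S (j + 1)) (A v)‖ ≤ γ * ‖v‖) → ∀ n,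
      ∃ y, trunc (S (n + 1)) y = y ∧
        ‖A (U - W) - y‖ ≤ C * (‖U - trunc (S 0) U‖ + (q ^ n + γ) * ‖U‖) := by
  have hM := hA.M_pos
  have hm := hA.m_pos
  set q₀ := √(1 - m / M) with hq₀
  have hq0 : 0 ≤ q₀ := Real.sqrt_nonneg _
  have hq1 : q₀ < 1 := by
    rw [hq₀, Real.sqrt_lt' one_pos]
    have : 0 < m / M := by positivity
    linarith
  -- A rate midway between q₀ and 1 leaves the margin (1 - q₀)/2, which absorbs the part of the
  -- truncation error proportional to the current error; this fixes γ₀.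
  set q := (1 + q₀) / 2 with hq
  have hq' : 0 < 1 - q := by rw [hq]; linarith
  set κ := M / m with hκ
  have hκ0 : 0 < κ := by positivity
  refine ⟨M + 2 * M * (1 + κ) + 2 * M / (1 - q) + 2 * (2 + κ) / (1 - q) + (2 + κ), q,
    M * ((1 - q₀) / 2), by positivity, by rw [hq]; linarith, by linarith,
    mul_pos hM (by linarith), ?_⟩
  intro Λ U W hW S hS γ hγ0 hγ₀ hγ n
  set V := trunc (S 0) U with hVdef
  have hV : trunc (S 0) V = V := trunc_trunc_of_subset (le_refl _) _
  set τ := ‖U - V‖ with hτ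
  set x := sparseRichardson A M Λ S V with hx
  set D : ℕ → ℝ := fun j => ‖W - x j‖ with hD
  have hWn : ‖W‖ ≤ (1 + κ) * ‖U‖ := by
    have h1 := hW.norm_sub_le hA
    have h2 : W = U - (U - W) := by abel
    calc ‖W‖ = ‖U - (U - W)‖ := by rw [← h2]
      _ ≤ ‖U‖ + ‖U - W‖ := norm_sub_le _ _
      _ ≤ ‖U‖ + κ * ‖U‖ := by gcongr
      _ = _ := by ring
  have hVx : ∀ j, ‖V - x j‖ ≤ (2 + κ) * ‖U‖ + D j := by
    intro j
    have h2 : V - x j = V - W + (W - x j) := by abel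
    calc ‖V - x j‖ ≤ ‖V - W‖ + ‖W - x j‖ := by rw [h2]; exact norm_add_le _ _
      _ ≤ (‖V‖ + ‖W‖) + D j := by gcongr; exact norm_sub_le _ _
      _ ≤ (‖U‖ + (1 + κ) * ‖U‖) + D j := by gcongr; exact norm_trunc_le _ _
      _ = _ := by ring
  have hMγ : M⁻¹ * γ ≤ (1 - q₀) / 2 := by
    rw [inv_mul_le_iff₀ hM]; exact hγ₀
  set b := τ + M⁻¹ * γ * ((2 + κ) * ‖U‖) with hb
  have hb0 : 0 ≤ b := by positivity
  have hrec : ∀ j, D (j + 1) ≤ q * D j + b := by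
    intro j
    have h1 := norm_sub_sparseRichardson_succ_le hA hW hS hγ hV j
    have h2 : M⁻¹ * (γ * ‖V - x j‖) ≤ M⁻¹ * (γ * ((2 + κ) * ‖U‖ + D j)) := by
      gcongr; exact hVx j
    have h3 : M⁻¹ * γ * D j ≤ (1 - q₀) / 2 * D j := by
      gcongr
    have h4 : D (j + 1) ≤ q₀ * D j + τ + M⁻¹ * (γ * ‖V - x j‖) := h1
    have h5 : q * D j = q₀ * D j + (1 - q₀) / 2 * D j := by rw [hq]; ring
    rw [h5, hb]
    linarith
  have hDn := le_geometric_of_affine_recurrence (by rw [hq]; linarith) (by linarith) hb0 hrec n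
  have hD0 : D 0 ≤ (1 + κ) * ‖U‖ := by
    have : x 0 = 0 := rfl
    simpa only [hD, this, sub_zero] using hWn
  have hqn : 0 ≤ q ^ n := pow_nonneg (by rw [hq]; linarith) n
  -- The residual with U and W replaced by their sparse substitutes, cut off to `S (n + 1)`; this
  -- set does not depend on Λ.
  refine ⟨trunc (S (n + 1)) (A (V - x n)), trunc_trunc_of_subset (le_refl _) _, ?_⟩
  have e1 : A (U - W) - trunc (S (n + 1)) (A (V - x n)) =
      A (U - V) - A (W - x n) + (A (V - x n) - trunc (S (n + 1)) (A (V - x n))) := by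
    have : A (U - W) = A (U - V) - A (W - x n) + A (V - x n) := by
      rw [← map_sub, ← map_add]; congr 1; abel
    rw [this]; abel
  have hsupp : trunc (S n) (V - x n) = V - x n := by
    rw [trunc_sub, trunc_sparseRichardson,
      trunc_eq_self_of_subset (monotone_nat_of_le_succ hS (Nat.zero_le n)) hV]
  have hγM : γ ≤ M := hγ₀.trans (by nlinarith)
  have h1 : ‖A (U - W) - trunc (S (n + 1)) (A (V - x n))‖ ≤
      M * τ + M * D n + γ * ((2 + κ) * ‖U‖ + D n) := by
    rw [e1]
    refine (norm_add_le _ _).trans (add_le_add ((norm_sub_le _ _).trans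
      (add_le_add (hA.norm_apply_le _) (hA.norm_apply_le _))) ?_)
    refine (hγ n _ hsupp).trans ?_
    gcongr
    exact hVx n
  have h2 : γ * D n ≤ M * D n := by gcongr
  have h3 : M * D n ≤ M * (q ^ n * ((1 + κ) * ‖U‖) + b / (1 - q)) := by
    gcongr
    exact hDn.trans (by gcongr)
  have h4 : M * (b / (1 - q)) = M / (1 - q) * τ + (2 + κ) / (1 - q) * γ * ‖U‖ := by
    rw [hb]; field_simp
  have hτ0 : 0 ≤ τ := norm_nonneg _
  have hU0 : 0 ≤ ‖U‖ := norm_nonneg _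
  have hqU : 0 ≤ q ^ n * ‖U‖ := by positivity
  have hγU : 0 ≤ γ * ‖U‖ := by positivity
  have c1 : 0 ≤ M / (1 - q) := by positivity
  have c2 : 0 ≤ (2 + κ) / (1 - q) := by positivity
  have c3 : 0 ≤ M * κ := by positivity
  have e2 : 2 * M / (1 - q) = 2 * (M / (1 - q)) := by ring
  have e3 : 2 * (2 + κ) / (1 - q) = 2 * ((2 + κ) / (1 - q)) := by ring
  rw [e2, e3]
  set c₁ := M / (1 - q)
  set c₂ := (2 + κ) / (1 - q)
  have i1 := mul_nonneg c1 hqU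
  have i2 := mul_nonneg c1 hγU
  have i3 := mul_nonneg c2 hqU
  have i4 := mul_nonneg c2 hτ0
  have i5 := mul_nonneg c3 hτ0
  have i6 := mul_nonneg c3 hγU
  have i7 := mul_nonneg hM.le hτ0
  have i8 := mul_nonneg hM.le hqU
  have i9 := mul_nonneg hM.le hγU
  have i10 := mul_nonneg hκ0.le hqU
  have i11 := mul_nonneg hκ0.le hτ0
  nlinarith

end Residual

/-! ### Lattice points -/

section Lattice

variable {d : ℕ}

theorem latticeDist_comm (k l : Fin d → ℤ) : latticeDist k l = latticeDist l k := by
  unfold latticeDist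
  rw [← norm_neg]
  congr 1
  ext i
  simp

theorem latticeDist_triangle (k l j : Fin d → ℤ) :
    latticeDist k j ≤ latticeDist k l + latticeDist l j := by
  unfold latticeDist
  refine le_trans (le_of_eq ?_) (norm_add_le _ _)
  congr 1
  ext i
  simp

theorem latticeDist_self (k : Fin d → ℤ) : latticeDist k k = 0 := by
  unfold latticeDist
  rw [norm_eq_zero]
  ext i
  simp

theorem abs_sub_le_latticeDist (k l : Fin d → ℤ) (i : Fin d) :
    |((k i - l i : ℤ) : ℝ)| ≤ latticeDist k l := by
  have := PiLp.norm_apply_le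
    (WithLp.toLp 2 fun i => ((k i - l i : ℤ) : ℝ) : EuclideanSpace ℝ (Fin d)) i
  simpa [latticeDist] using this

variable {K : Set (Fin d → ℤ)}

/-- A Euclidean ball lies in the cube of the same radius, so T is contained in S plus an integer
cube. Both finiteness and the cardinality bound come from this. -/
theorem image_val_subset_of_near {S T : Finset K} {ρ : ℝ}
    (h : ∀ k ∈ T, ∃ l ∈ S, latticeDist k.1 l.1 ≤ ρ) :
    T.image Subtype.val ⊆ (S ×ˢ Fintype.piFinset fun _ : Fin d => Finset.Icc (-⌊ρ⌋) ⌊ρ⌋).image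
      fun x => x.1.1 + x.2 := by
  intro z hz
  obtain ⟨k, hk, rfl⟩ := Finset.mem_image.1 hz
  obtain ⟨l, hl, hd⟩ := h k hk
  refine Finset.mem_image.2 ⟨(l, k.1 - l.1), Finset.mem_product.2 ⟨hl, ?_⟩, by simp⟩
  rw [Fintype.mem_piFinset]
  intro i
  have h1 := (abs_sub_le_latticeDist k.1 l.1 i).trans hd
  rw [abs_le] at h1
  rw [Finset.mem_Icc]
  constructor
  · rw [neg_le, Int.le_floor]
    push_cast at h1 ⊢
    simp only [Pi.sub_apply, Int.cast_sub]
    linarith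
  · rw [Int.le_floor]
    simpa using h1.2

theorem card_le_of_near {S T : Finset K} {ρ : ℝ} (hρ : 0 ≤ ρ)
    (h : ∀ k ∈ T, ∃ l ∈ S, latticeDist k.1 l.1 ≤ ρ) :
    (T.card : ℝ) ≤ S.card * (2 * ρ + 1) ^ d := by
  have h1 := (Finset.card_le_card (image_val_subset_of_near h)).trans Finset.card_image_le
  rw [Finset.card_image_of_injective _ Subtype.val_injective, Finset.card_product,
    Fintype.card_piFinset_const, Int.card_Icc] at h1
  have h2 : ((⌊ρ⌋ + 1 - -⌊ρ⌋).toNat : ℝ) ≤ 2 * ρ + 1 := by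
    have h3 : 0 ≤ ⌊ρ⌋ := Int.floor_nonneg.2 hρ
    have h4 : (((⌊ρ⌋ + 1 - -⌊ρ⌋).toNat : ℤ) : ℝ) = ((⌊ρ⌋ + 1 - -⌊ρ⌋ : ℤ) : ℝ) := by
      rw [Int.toNat_of_nonneg (by omega)]
    have h5 := Int.floor_le ρ
    rw [Int.cast_natCast] at h4
    rw [h4]
    push_cast
    linarith
  calc (T.card : ℝ) ≤ ((S.card * (⌊ρ⌋ + 1 - -⌊ρ⌋).toNat ^ d : ℕ) : ℝ) := by exact_mod_cast h1
    _ = S.card * ((⌊ρ⌋ + 1 - -⌊ρ⌋).toNat : ℝ) ^ d := by push_cast; ring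
    _ ≤ _ := by gcongr

theorem finite_near (S : Finset K) (ρ : ℝ) :
    {k : K | ∃ l ∈ S, latticeDist k.1 l.1 ≤ ρ}.Finite := by
  refine Set.Finite.of_finite_image (f := Subtype.val) ?_ Subtype.val_injective.injOn
  refine Set.Finite.subset ((S ×ˢ Fintype.piFinset fun _ : Fin d =>
    Finset.Icc (-⌊ρ⌋) ⌊ρ⌋).image fun x => x.1.1 + x.2).finite_toSet ?_
  rintro _ ⟨k, ⟨l, hl, hd⟩, rfl⟩
  exact image_val_subset_of_near (S := S) (T := {k}) (ρ := ρ) (by simpa using ⟨l.1, ⟨l.2, hl⟩, hd⟩)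
    (by simp)

/-- The set of indices at distance at most `ρ` from `S`. -/
def enlarge (S : Finset K) (ρ : ℝ) : Finset K := (finite_near S ρ).toFinset

theorem mem_enlarge {S : Finset K} {ρ : ℝ} {k : K} :
    k ∈ enlarge S ρ ↔ ∃ l ∈ S, latticeDist k.1 l.1 ≤ ρ := by
  simp [enlarge]

theorem card_enlarge_le (S : Finset K) {ρ : ℝ} (hρ : 0 ≤ ρ) :
    ((enlarge S ρ).card : ℝ) ≤ S.card * (2 * ρ + 1) ^ d :=
  card_le_of_near hρ fun _ hk => mem_enlarge.1 hk

/-! ### Exponential sums over the lattice and Schur's test. -/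

theorem summable_exp_neg_mul_abs_int {b : ℝ} (hb : 0 < b) :
    Summable fun j : ℤ => Real.exp (-b * |(j : ℝ)|) := by
  have h : Summable fun n : ℕ => Real.exp (-b * (n : ℝ)) := by
    have := Real.summable_exp_nat_mul_iff.2 (neg_lt_zero.2 hb)
    simpa only [mul_comm] using this
  refine Summable.of_nat_of_neg ?_ ?_
  · simpa using h
  · simpa using h

/-- The ℓ¹ distance is at most d times the Euclidean one, so with rate a/d the sum is dominated by a
product of d geometric sums over ℤ. -/
theorem exists_sum_exp_neg_latticeDist_le (hd : 1 ≤ d) {a : ℝ} (ha : 0 < a) :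
    ∃ Z : ℝ, 0 < Z ∧ ∀ (l : Fin d → ℤ) (T : Finset (Fin d → ℤ)),
      ∑ k ∈ T, Real.exp (-a * latticeDist k l) ≤ Z := by
  have hd' : (0 : ℝ) < d := by exact_mod_cast hd
  set b := a / d with hb
  have hb0 : 0 < b := by positivity
  have hs := summable_exp_neg_mul_abs_int hb0
  set Z₁ := ∑' j : ℤ, Real.exp (-b * |(j : ℝ)|) with hZ₁
  have hZ₁0 : 0 < Z₁ := hs.tsum_pos (fun _ => (Real.exp_pos _).le) 0 (Real.exp_pos _)
  refine ⟨Z₁ ^ d, by positivity, fun l T => ?_⟩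
  have h1 : ∀ k : Fin d → ℤ, Real.exp (-a * latticeDist k l) ≤
      ∏ i, Real.exp (-b * |((k i - l i : ℤ) : ℝ)|) := by
    intro k
    rw [← Real.exp_sum, ← Finset.mul_sum]
    refine Real.exp_le_exp.2 ?_
    have h2 : ∑ i, |((k i - l i : ℤ) : ℝ)| ≤ d * latticeDist k l := by
      refine (Finset.sum_le_sum fun i _ => abs_sub_le_latticeDist k l i).trans ?_
      simp
    have h3 : a * latticeDist k l = b * (d * latticeDist k l) := by rw [hb]; field_simp
    rw [neg_mul, neg_mul, neg_le_neg_iff, h3]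
    gcongr
  have h2 : T ⊆ Fintype.piFinset fun i => T.image fun k => k i := by
    intro k hk
    rw [Fintype.mem_piFinset]
    exact fun i => Finset.mem_image_of_mem _ hk
  calc ∑ k ∈ T, Real.exp (-a * latticeDist k l)
      ≤ ∑ k ∈ T, ∏ i, Real.exp (-b * |((k i - l i : ℤ) : ℝ)|) := Finset.sum_le_sum fun k _ => h1 k
    _ ≤ ∑ k ∈ Fintype.piFinset fun i => T.image fun k => k i,
          ∏ i, Real.exp (-b * |((k i - l i : ℤ) : ℝ)|) :=
        Finset.sum_le_sum_of_subset_of_nonneg h2 fun _ _ _ => by positivity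
    _ = ∏ i, ∑ j ∈ T.image fun k => k i, Real.exp (-b * |((j - l i : ℤ) : ℝ)|) :=
        (Finset.prod_univ_sum (fun i => T.image fun k => k i)
          fun i j => Real.exp (-b * |((j - l i : ℤ) : ℝ)|)).symm
    _ ≤ ∏ _i : Fin d, Z₁ := by
        refine Finset.prod_le_prod (fun _ _ => by positivity) fun i _ => ?_
        have hinj : Function.Injective fun j : ℤ => j - l i := sub_left_injective
        rw [← Finset.sum_image (s := T.image fun k => k i) (g := fun j : ℤ => j - l i)
          (f := fun j : ℤ => Real.exp (-b * |(j : ℝ)|)) (hinj.injOn)]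
        exact hs.sum_le_tsum _ fun _ _ => (Real.exp_pos _).le
    _ = Z₁ ^ d := by simp

/-- Schur's test for the entries of an exponentially decaying matrix at distance more than `J` from
the support of the argument. -/
theorem exists_norm_sub_trunc_apply_le (hd : 1 ≤ d) {𝕜 : Type} [RCLike 𝕜]
    {A : lp (fun _ : K => 𝕜) 2 →L[𝕜] lp (fun _ : K => 𝕜) 2} {c a : ℝ} (ha : 0 < a)
    (hA : ∀ l k : K, ‖A (lp.single 2 k 1) l‖ ≤ c * Real.exp (-a * latticeDist l.1 k.1)) :
    ∃ C : ℝ, 0 < C ∧ ∀ (J : ℝ) (S T : Finset K),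
      (∀ l : K, ∀ k ∈ S, latticeDist l.1 k.1 ≤ J → l ∈ T) →
      ∀ v, trunc S v = v → ‖A v - trunc T (A v)‖ ≤ C * Real.exp (-(a / 2) * J) * ‖v‖ := by
  obtain ⟨Z, hZ, hZsum⟩ := exists_sum_exp_neg_latticeDist_le hd (half_pos ha)
  have hZK : ∀ (l : K) (T : Finset K), ∑ k ∈ T, Real.exp (-(a / 2) * latticeDist k.1 l.1) ≤ Z := by
    intro l T
    have := hZsum l.1 (T.image Subtype.val)
    rwa [Finset.sum_image Subtype.val_injective.injOn] at this
  refine ⟨(|c| + 1) * Z, by positivity, fun J S T hT v hv => ?_⟩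
  set e := Real.exp (-(a / 2) * J) with he
  set c' := |c| + 1 with hc'
  have hc0 : 0 < c' := by positivity
  set w : K → K → ℝ := fun l k => Real.exp (-(a / 2) * latticeDist l.1 k.1) with hw
  have hws : ∀ l k, w l k = w k l := fun l k => by simp only [hw, latticeDist_comm]
  have hw0 : ∀ l k, 0 < w l k := fun l k => Real.exp_pos _
  have hAv : ∀ l, A v l = ∑ k ∈ S, v k * A (lp.single 2 k 1) l := by
    intro l
    have h1 : v = ∑ k ∈ S, v k • lp.single (E := fun _ : K => 𝕜) 2 k (1 : 𝕜) := by
      conv_lhs => rw [← hv]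
      refine Finset.sum_congr rfl fun k _ => ?_
      rw [← lp.single_smul]; simp
    conv_lhs => rw [h1]
    simp only [map_sum, map_smul, lp.coeFn_sum, Finset.sum_apply, lp.coeFn_smul, Pi.smul_apply,
      smul_eq_mul]
  have hpt : ∀ l, ‖(A v - trunc T (A v)) l‖ ≤ c' * e * ∑ k ∈ S, w l k * ‖v k‖ := by
    intro l
    rw [lp.coeFn_sub, Pi.sub_apply, trunc_apply]
    split_ifs with hl
    · rw [sub_self, norm_zero]
      have := Finset.sum_nonneg fun k (_ : k ∈ S) => mul_nonneg (hw0 l k).le (norm_nonneg (v k))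
      positivity
    · rw [sub_zero, hAv, Finset.mul_sum]
      refine (norm_sum_le _ _).trans (Finset.sum_le_sum fun k hk => ?_)
      have hJ : J < latticeDist l.1 k.1 := by
        by_contra hcon
        exact hl (hT l k hk (not_lt.1 hcon))
      -- Beyond distance J, half of the decay rate pays for the factor e and the other half remains
      -- as the summable weight w.
      have h1 : c * Real.exp (-a * latticeDist l.1 k.1) ≤ c' * (e * w l k) := by
        rw [he, hw, ← Real.exp_add]
        refine mul_le_mul ((le_abs_self c).trans (by rw [hc']; linarith)) ?_ (Real.exp_pos _).le
          hc0.le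
        refine Real.exp_le_exp.2 ?_
        nlinarith
      rw [norm_mul, mul_comm]
      calc ‖A (lp.single 2 k 1) l‖ * ‖v k‖ ≤ c' * (e * w l k) * ‖v k‖ := by
            gcongr; exact (hA l k).trans h1
        _ = _ := by ring
  refine lp.norm_le_of_forall_sum_le (p := 2) (by norm_num) (by positivity) fun s => ?_
  -- Cauchy–Schwarz with weight w uses the row sums; the column sums enter after exchanging the
  -- order of summation.
  have hCS : ∀ l, (∑ k ∈ S, w l k * ‖v k‖) ^ 2 ≤ Z * ∑ k ∈ S, w l k * ‖v k‖ ^ 2 := by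
    intro l
    have h1 := Finset.sum_sq_le_sum_mul_sum_of_sq_le_mul S (r := fun k => w l k * ‖v k‖)
      (f := fun k => w l k) (g := fun k => w l k * ‖v k‖ ^ 2) (fun k _ => (hw0 l k).le)
      (fun k _ => mul_nonneg (hw0 l k).le (sq_nonneg _)) (fun k _ => le_of_eq (by ring))
    refine h1.trans (mul_le_mul_of_nonneg_right ?_ ?_)
    · simp only [hws l]
      exact hZK l S
    · exact Finset.sum_nonneg fun k _ => mul_nonneg (hw0 l k).le (sq_nonneg _)
  have hv2 : ∑ k ∈ S, ‖v k‖ ^ 2 = ‖v‖ ^ 2 := by rw [← norm_sq_trunc, hv]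
  simp only [ENNReal.toReal_ofNat, Real.rpow_ofNat]
  calc ∑ l ∈ s, ‖(A v - trunc T (A v)) l‖ ^ 2
      ≤ ∑ l ∈ s, (c' * e) ^ 2 * (Z * ∑ k ∈ S, w l k * ‖v k‖ ^ 2) := by
        refine Finset.sum_le_sum fun l _ => ?_
        calc _ ≤ (c' * e * ∑ k ∈ S, w l k * ‖v k‖) ^ 2 := by gcongr; exact hpt l
          _ = (c' * e) ^ 2 * (∑ k ∈ S, w l k * ‖v k‖) ^ 2 := by ring
          _ ≤ _ := by gcongr; exact hCS l
    _ = (c' * e) ^ 2 * Z * ∑ k ∈ S, ‖v k‖ ^ 2 * ∑ l ∈ s, w l k := by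
        rw [← Finset.mul_sum, ← Finset.mul_sum, Finset.sum_comm, ← mul_assoc]
        congr 1
        refine Finset.sum_congr rfl fun k _ => ?_
        rw [Finset.mul_sum]
        exact Finset.sum_congr rfl fun l _ => mul_comm _ _
    _ ≤ (c' * e) ^ 2 * Z * ∑ k ∈ S, ‖v k‖ ^ 2 * Z := by
        gcongr with k _
        exact hZK k s
    _ = (c' * Z * e * ‖v‖) ^ 2 := by
        rw [← Finset.sum_mul, hv2]; ring

end Lattice

/-! ### Cardinality of the sets marked by the algorithm -/

/-- Serves to choose both the number of sweeps and their width. The bound has 1 - log ε > 1 rather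
than -log ε so that log c and the rounding fit into the constant. -/
theorem exists_nat_exp_neg_mul_le {b c : ℝ} (hb : 0 < b) (hc : 0 < c) :
    ∃ C : ℝ, 0 < C ∧ ∀ ε : ℝ, 0 < ε → ε < 1 →
      ∃ n : ℕ, Real.exp (-b * n) ≤ c * ε ^ 2 ∧ (n : ℝ) ≤ C * (1 - Real.log ε) := by
  refine ⟨(|Real.log c| + 2) / b + 1, by positivity, fun ε hε hε1 => ?_⟩
  have hl : Real.log ε < 0 := Real.log_neg hε hε1
  have h0 : 0 ≤ (|Real.log c| + 2) / b * (1 - Real.log ε) :=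
    mul_nonneg (by positivity) (by linarith)
  refine ⟨⌈(|Real.log c| + 2) / b * (1 - Real.log ε)⌉₊, ?_, ?_⟩
  · have h1 : (|Real.log c| + 2) / b * (1 - Real.log ε) ≤
        (⌈(|Real.log c| + 2) / b * (1 - Real.log ε)⌉₊ : ℝ) := Nat.le_ceil _
    have h2 : c * ε ^ 2 = Real.exp (Real.log c + 2 * Real.log ε) := by
      rw [Real.exp_add, Real.exp_log hc, mul_comm 2, Real.exp_mul, Real.exp_log hε, Real.rpow_ofNat]
    rw [h2]
    refine Real.exp_le_exp.2 ?_
    have h3 := mul_le_mul_of_nonneg_left h1 hb.le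
    have h4 : b * ((|Real.log c| + 2) / b * (1 - Real.log ε)) =
      (|Real.log c| + 2) * (1 - Real.log ε) := by field_simp
    rw [h4] at h3
    have h5 := neg_abs_le (Real.log c)
    nlinarith [abs_nonneg (Real.log c)]
  · have h1 := Nat.ceil_lt_add_one h0
    linarith

section Marking

variable {d : ℕ} {K : Set (Fin d → ℤ)} {𝕜 : Type} [RCLike 𝕜]
  {A : lp (fun _ : K => 𝕜) 2 →L[𝕜] lp (fun _ : K => 𝕜) 2} {m M : ℝ}

/-- The accuracy ε² is what dynamic marking demands when the residual has size about ε‖A U‖. In the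
exponent, 1/s counts the indices that approximate U, and 2d comes from a radius of order L², namely
O(L) sweeps of width O(L). -/
theorem exists_sparse_support_residual (hd : 1 ≤ d) (hA : IsElliptic A m M) {c a : ℝ} (ha : 0 < a)
    (hdecay : ∀ l k : K, ‖A (lp.single 2 k 1) l‖ ≤ c * Real.exp (-a * latticeDist l.1 k.1))
    {C₀ η s : ℝ} (hC₀ : 0 < C₀) (hη : 0 < η) (hs : 0 < s) :
    ∃ C CS : ℝ, 0 < C ∧ 0 < CS ∧ ∀ (U : lp (fun _ : K => 𝕜) 2) (G ε L : ℝ), U ≠ 0 → ‖U‖ ≤ G →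
      (∀ N : ℕ, ∃ S : Finset K, S.card ≤ N ∧
        ‖U - trunc S U‖ ≤ 2 * (G * Real.exp (-(η * (N : ℝ) ^ s)))) →
      0 < ε → ε < 1 → L = Real.log (CS * (G / ‖A U‖) / ε) →
      1 - Real.log ε ≤ L ∧
      ∀ (Λ : Finset K) (W : lp (fun _ : K => 𝕜) 2), IsGalerkinSeq A Λ U W →
        ∃ S : Finset K, ‖A (U - W) - trunc S (A (U - W))‖ ≤ C₀ * ε ^ 2 * ‖A U‖ ∧
          (S.card : ℝ) ≤ C * L ^ (s⁻¹ + 2 * d) := by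
  have hm := hA.m_pos
  have hM := hA.M_pos
  obtain ⟨C₁, q, γ₀, hC₁, hq0, hq1, hγ₀, happrox⟩ := exists_sparse_approx_residual hA
  obtain ⟨C₂, hC₂, hschur⟩ := exists_norm_sub_trunc_apply_le hd ha hdecay
  -- Share of each error source: approximation of U counts once, sweeps and truncation once each
  -- with ‖U‖ ≤ ‖A U‖/m.
  set c₃ := C₀ / (C₁ * (1 + 2 / m)) with hc₃
  have hc₃0 : 0 < c₃ := by positivity
  have hlq : 0 < -Real.log q := neg_pos.2 (Real.log_neg hq0 hq1)
  obtain ⟨Cn, hCn, hn⟩ := exists_nat_exp_neg_mul_le hlq hc₃0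
  obtain ⟨CJ, hCJ, hJ⟩ := exists_nat_exp_neg_mul_le (half_pos ha)
    (div_pos (lt_min hc₃0 hγ₀) hC₂)
  refine ⟨((2 / η) ^ s⁻¹ + 1) * (2 * (Cn + 1) * CJ + 1) ^ d,
    max (max 1 (2 * M / c₃)) (Real.exp 1 * M), by positivity, by positivity, ?_⟩
  -- The first two entries absorb the constants in the approximation of U. The third gives CS · g ≥
  -- e, because M g ≥ 1, and hence L ≥ 1 - log ε.
  set CS := max (max 1 (2 * M / c₃)) (Real.exp 1 * M) with hCS
  have hCS1 : 1 ≤ CS := (le_max_left _ _).trans (le_max_left _ _)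
  have hCS2 : 2 * M / c₃ ≤ CS := (le_max_right _ _).trans (le_max_left _ _)
  have hCS3 : Real.exp 1 * M ≤ CS := le_max_right _ _
  intro U G ε L hU hUG hG hε hε1 hL
  have hU0 : 0 < ‖U‖ := norm_pos_iff.2 hU
  have hφ : 0 < ‖A U‖ := (mul_pos hm hU0).trans_le (hA.norm_le_apply U)
  have hG0 : 0 < G := hU0.trans_le hUG
  set φ := ‖A U‖ with hφdef
  set g := G / φ with hg
  have hg0 : 0 < g := div_pos hG0 hφ
  have hgM : 1 ≤ M * g := by
    rw [hg, ← mul_div_assoc, one_le_div hφ]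
    exact (hA.norm_apply_le U).trans (by gcongr)
  have hlε : Real.log ε < 0 := Real.log_neg hε hε1
  have hCSg : Real.exp 1 ≤ CS * g := by
    calc Real.exp 1 ≤ Real.exp 1 * (M * g) := le_mul_of_one_le_right (Real.exp_pos _).le hgM
      _ = Real.exp 1 * M * g := by ring
      _ ≤ CS * g := by gcongr
  have hCSg0 : 0 < CS * g := by positivity
  have hL' : L = Real.log (CS * g) - Real.log ε := by
    rw [hL, Real.log_div hCSg0.ne' hε.ne']
  have hlog1 : 1 ≤ Real.log (CS * g) := (Real.le_log_iff_exp_le hCSg0).2 hCSg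
  have hεL : 1 - Real.log ε ≤ L := by linarith
  have hL1 : 1 ≤ L := by linarith
  refine ⟨hεL, fun Λ W hW => ?_⟩
  obtain ⟨n, hn1, hn2⟩ := hn ε hε hε1
  obtain ⟨J, hJ1, hJ2⟩ := hJ ε hε hε1
  have hε2 : ε ^ 2 ≤ 1 := pow_le_one₀ hε.le hε1.le
  set γ := C₂ * Real.exp (-(a / 2) * J) with hγ
  have hγ1 : γ ≤ min c₃ γ₀ * ε ^ 2 := by
    calc γ ≤ C₂ * (min c₃ γ₀ / C₂ * ε ^ 2) := by rw [hγ]; gcongr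
      _ = _ := by field_simp
  have hmin0 : 0 < min c₃ γ₀ := lt_min hc₃0 hγ₀
  have hγc : γ ≤ c₃ * ε ^ 2 := hγ1.trans (by gcongr; exact min_le_left _ _)
  have hγγ : γ ≤ γ₀ := hγ1.trans ((mul_le_of_le_one_right hmin0.le hε2).trans (min_le_right _ _))
  have hqn : q ^ n ≤ c₃ * ε ^ 2 := by
    refine le_trans (le_of_eq ?_) hn1
    rw [neg_neg, mul_comm, Real.exp_nat_mul, Real.exp_log hq0]
  -- With N = ⌈x^(1/s)⌉ terms, exp(-η N^s) ≤ exp(-2L), which is of order ε².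
  set x := 2 / η * L with hx
  have hx0 : 0 < x := by positivity
  obtain ⟨S₀, hS₀, hS₀'⟩ := hG ⌈x ^ s⁻¹⌉₊
  have hτ : ‖U - trunc S₀ U‖ ≤ c₃ * ε ^ 2 * φ := by
    refine hS₀'.trans ?_
    have h1 : x ≤ (⌈x ^ s⁻¹⌉₊ : ℝ) ^ s := by
      calc x = (x ^ s⁻¹) ^ s := (Real.rpow_inv_rpow hx0.le hs.ne').symm
        _ ≤ _ := by
          gcongr
          exact Nat.le_ceil _
    have h2 : Real.exp (-(η * (⌈x ^ s⁻¹⌉₊ : ℝ) ^ s)) ≤ Real.exp (-(2 * L)) := by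
      refine Real.exp_le_exp.2 (neg_le_neg ?_)
      calc 2 * L = η * x := by rw [hx]; field_simp
        _ ≤ _ := by gcongr
    have h3 : Real.exp (-(2 * L)) = ((CS * g) ^ 2)⁻¹ * ε ^ 2 := by
      rw [Real.exp_neg, mul_comm 2, Real.exp_mul, hL, Real.exp_log (by positivity), Real.rpow_ofNat]
      field_simp
    have h4 : 2 * g * ((CS * g) ^ 2)⁻¹ ≤ c₃ := by
      rw [← div_eq_mul_inv, div_le_iff₀ (by positivity)]
      have h5 : 2 * M ≤ c₃ * CS := by
        have := (div_le_iff₀ hc₃0).1 hCS2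
        linarith
      have h6 : 2 ≤ c₃ * CS * CS * g := by
        calc (2 : ℝ) ≤ 2 * (M * g) := by linarith
          _ = 2 * M * g := by ring
          _ ≤ c₃ * CS * g := by gcongr
          _ ≤ c₃ * CS * CS * g := by
            have : c₃ * CS ≤ c₃ * CS * CS := le_mul_of_one_le_right (by positivity) hCS1
            gcongr
      calc 2 * g ≤ c₃ * CS * CS * g * g := by gcongr
        _ = _ := by ring
    calc 2 * (G * Real.exp (-(η * (⌈x ^ s⁻¹⌉₊ : ℝ) ^ s)))
        ≤ 2 * (G * (((CS * g) ^ 2)⁻¹ * ε ^ 2)) := by rw [← h3]; gcongr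
      _ = 2 * g * ((CS * g) ^ 2)⁻¹ * ε ^ 2 * φ := by rw [hg]; field_simp
      _ ≤ _ := by gcongr
  -- Radii add up by the triangle inequality, so one hop of length J leads from `S j` into `S (j +
  -- 1)`.
  set S : ℕ → Finset K := fun j => enlarge S₀ (j * J) with hS
  have hSsucc : ∀ (j : ℕ) (l k : K), k ∈ S j → latticeDist l.1 k.1 ≤ J → l ∈ S (j + 1) := by
    intro j l k hk hlk
    obtain ⟨i, hi, hki⟩ := mem_enlarge.1 hk
    refine mem_enlarge.2 ⟨i, hi, (latticeDist_triangle _ k.1 _).trans ?_⟩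
    push_cast
    linarith
  have hSmono : ∀ j, S j ⊆ S (j + 1) := fun j k hk =>
    hSsucc j k k hk (by rw [latticeDist_self]; positivity)
  have hS0 : S₀ ⊆ S 0 := fun k hk =>
    mem_enlarge.2 ⟨k, hk, by rw [latticeDist_self]; positivity⟩
  obtain ⟨y, hy, hyR⟩ := happrox Λ U W hW S hSmono γ (by positivity) hγγ
    (fun j v hv => hschur J (S j) (S (j + 1)) (hSsucc j) v hv) n
  refine ⟨S (n + 1), (norm_sub_trunc_le_norm_sub _ _ hy).trans (hyR.trans ?_), ?_⟩
  · have h1 : ‖U - trunc (S 0) U‖ ≤ c₃ * ε ^ 2 * φ :=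
      (norm_sub_trunc_le_norm_sub _ _ (trunc_trunc_of_subset hS0 U)).trans hτ
    have h2 : ‖U‖ ≤ φ / m := by
      rw [le_div_iff₀ hm, mul_comm]; exact hA.norm_le_apply U
    calc C₁ * (‖U - trunc (S 0) U‖ + (q ^ n + γ) * ‖U‖)
        ≤ C₁ * (c₃ * ε ^ 2 * φ + (c₃ * ε ^ 2 + c₃ * ε ^ 2) * (φ / m)) := by gcongr
      _ = C₁ * (1 + 2 / m) * c₃ * ε ^ 2 * φ := by ring
      _ = C₀ * ε ^ 2 * φ := by rw [hc₃, mul_div_cancel₀ _ (by positivity)]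
  · have h1 := card_enlarge_le S₀ (ρ := ((n + 1 : ℕ) : ℝ) * J) (by positivity)
    refine h1.trans ?_
    have hcard : (S₀.card : ℝ) ≤ ((2 / η) ^ s⁻¹ + 1) * L ^ s⁻¹ := by
      have h2 : (S₀.card : ℝ) ≤ (⌈x ^ s⁻¹⌉₊ : ℝ) := by exact_mod_cast hS₀
      have h3 := Nat.ceil_lt_add_one (Real.rpow_nonneg hx0.le s⁻¹)
      have h4 : x ^ s⁻¹ = (2 / η) ^ s⁻¹ * L ^ s⁻¹ := by
        rw [hx, Real.mul_rpow (by positivity) (by positivity)]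
      have h5 : 1 ≤ L ^ s⁻¹ := Real.one_le_rpow hL1 (by positivity)
      linarith
    have hrad : 2 * (((n + 1 : ℕ) : ℝ) * J) + 1 ≤ (2 * (Cn + 1) * CJ + 1) * L ^ 2 := by
      have h2 : ((n + 1 : ℕ) : ℝ) ≤ (Cn + 1) * L := by
        push_cast
        have : (n : ℝ) ≤ Cn * L := hn2.trans (by gcongr)
        linarith
      have h3 : (J : ℝ) ≤ CJ * L := hJ2.trans (by gcongr)
      have h4 : ((n + 1 : ℕ) : ℝ) * J ≤ (Cn + 1) * L * (CJ * L) := by gcongr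
      have h5 : 1 ≤ L ^ 2 := one_le_pow₀ hL1
      linarith
    calc (S₀.card : ℝ) * (2 * (((n + 1 : ℕ) : ℝ) * J) + 1) ^ d
        ≤ (((2 / η) ^ s⁻¹ + 1) * L ^ s⁻¹) * ((2 * (Cn + 1) * CJ + 1) * L ^ 2) ^ d := by gcongr
      _ = ((2 / η) ^ s⁻¹ + 1) * (2 * (Cn + 1) * CJ + 1) ^ d * (L ^ s⁻¹ * L ^ (2 * d)) := by
        rw [mul_pow _ (L ^ 2), ← pow_mul]; ring
      _ = _ := by
        rw [Real.rpow_add (by positivity), ← Real.rpow_natCast L (2 * d)]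
        push_cast
        rfl

/-! ### Complexity of the sequence of Galerkin approximations -/

/-- One pass of the algorithm in terms of coefficient sequences: dynamic Dörfler marking, followed
by an enrichment with radius at most `ρ` and a Galerkin solve. -/
def IsSparseStep (A : lp (fun _ : K => 𝕜) 2 →L[𝕜] lp (fun _ : K => 𝕜) 2) (C₀ ρ : ℝ)
    (U : lp (fun _ : K => 𝕜) 2) (Λ : Finset K) (W : lp (fun _ : K => 𝕜) 2) (Λ' : Finset K)
    (W' : lp (fun _ : K => 𝕜) 2) : Prop :=
  ∃ S : Finset K,
    (1 - C₀ ^ 2 * ‖A (U - W)‖ ^ 2 / ‖A U‖ ^ 2) * ‖A (U - W)‖ ^ 2 ≤ ‖trunc S (A (U - W))‖ ^ 2 ∧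
    (∀ S' : Finset K, (1 - C₀ ^ 2 * ‖A (U - W)‖ ^ 2 / ‖A U‖ ^ 2) * ‖A (U - W)‖ ^ 2 ≤
      ‖trunc S' (A (U - W))‖ ^ 2 → S.card ≤ S'.card) ∧
    S ⊆ Λ' ∧ Λ ⊆ Λ' ∧ (∀ k ∈ Λ', k ∈ Λ ∨ ∃ l ∈ S, latticeDist k.1 l.1 ≤ ρ) ∧
    IsGalerkinSeq A Λ' U W'

/-- The energy error is monotone although the residual norm need not be. This bounds 1 - θ² along
the whole run. -/
theorem norm_apply_sub_sq_le (hA : IsElliptic A m M) {Λ : Finset K} {U W : lp (fun _ : K => 𝕜) 2}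
    (hW : IsGalerkinSeq A Λ U W) : ‖A (U - W)‖ ^ 2 ≤ M / m * ‖A U‖ ^ 2 := by
  have h1 := hA.norm_apply_sq_le (U - W)
  have h2 := hW.energy_le hA (trunc_zero Λ)
  rw [sub_zero] at h2
  have h3 := hA.mul_energy_le U
  have hm := hA.m_pos
  have hM := hA.M_pos
  calc ‖A (U - W)‖ ^ 2 ≤ M * energy A U := h1.trans (by gcongr)
    _ = M / m * (m * energy A U) := by field_simp
    _ ≤ _ := by gcongr

/-- The condition on C₀ gives θ² ≥ 1/2, so `IsGalerkinSeq.energy_le_mul` applies with ρ = 1/2. -/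
theorem IsSparseStep.energy_le (hA : IsElliptic A m M) {C₀ ρ : ℝ} (hC₀ : C₀ ^ 2 * (M / m) ≤ 1 / 2)
    {U W W' : lp (fun _ : K => 𝕜) 2} {Λ Λ' : Finset K} (hU : U ≠ 0) (hW : IsGalerkinSeq A Λ U W)
    (h : IsSparseStep A C₀ ρ U Λ W Λ' W') :
    energy A (U - W') ≤ (1 - m / (2 * M)) * energy A (U - W) := by
  obtain ⟨S, hbulk, -, hS, hΛ, -, hW'⟩ := h
  have hm := hA.m_pos
  have hM := hA.M_pos
  have hφ : 0 < ‖A U‖ := (mul_pos hm (norm_pos_iff.2 hU)).trans_le (hA.norm_le_apply U)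
  have h1 : C₀ ^ 2 * ‖A (U - W)‖ ^ 2 / ‖A U‖ ^ 2 ≤ 1 / 2 := by
    rw [div_le_iff₀ (by positivity)]
    calc C₀ ^ 2 * ‖A (U - W)‖ ^ 2 ≤ C₀ ^ 2 * (M / m * ‖A U‖ ^ 2) := by
          gcongr; exact norm_apply_sub_sq_le hA hW
      _ = C₀ ^ 2 * (M / m) * ‖A U‖ ^ 2 := by ring
      _ ≤ _ := by gcongr
  have h2 := hW'.energy_le_mul hA (trunc_eq_self_of_subset hΛ hW.supp) hS (ρ := 1 / 2)
    (by norm_num) (le_trans (by gcongr; linarith) hbulk)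
  refine h2.trans (le_of_eq ?_)
  congr 2
  field_simp

/-- By Pythagoras a set with a small enough tail satisfies the bulk criterion, so the minimal marked
set is no larger. -/
theorem IsSparseStep.card_le {C₀ ρ b : ℝ} (hρ : 0 ≤ ρ)
    {U W W' : lp (fun _ : K => 𝕜) 2} {Λ Λ' S : Finset K}
    (h : IsSparseStep A C₀ ρ U Λ W Λ' W')
    (hS : ‖A (U - W) - trunc S (A (U - W))‖ ^ 2 ≤
      C₀ ^ 2 * ‖A (U - W)‖ ^ 2 / ‖A U‖ ^ 2 * ‖A (U - W)‖ ^ 2) (hSb : (S.card : ℝ) ≤ b) :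
    (Λ'.card : ℝ) ≤ Λ.card + b * (2 * ρ + 1) ^ d := by
  obtain ⟨S₁, -, hmin, -, hΛ, hnear, -⟩ := h
  have h1 : (S₁.card : ℝ) ≤ b := by
    refine le_trans ?_ hSb
    exact_mod_cast hmin S (by
      have := norm_sq_eq_trunc_add S (A (U - W))
      linarith)
  have h2 : ((Λ' \ Λ).card : ℝ) ≤ S₁.card * (2 * ρ + 1) ^ d := by
    refine card_le_of_near hρ fun k hk => ?_
    rw [Finset.mem_sdiff] at hk
    exact (hnear k hk.1).resolve_left hk.2
  have h3 : (Λ'.card : ℝ) = (Λ' \ Λ).card + Λ.card := by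
    exact_mod_cast (Finset.card_sdiff_add_card_eq_card hΛ).symm
  rw [h3]
  have h4 : (S₁.card : ℝ) * (2 * ρ + 1) ^ d ≤ b * (2 * ρ + 1) ^ d := by gcongr
  linarith

theorem exists_run_bounds (hd : 1 ≤ d) (hA : IsElliptic A m M) {c a : ℝ} (ha : 0 < a)
    (hdecay : ∀ l k : K, ‖A (lp.single 2 k 1) l‖ ≤ c * Real.exp (-a * latticeDist l.1 k.1))
    {C₀ η s Cρ : ℝ} (hC₀ : 0 < C₀) (hC₀M : C₀ ^ 2 * (M / m) ≤ 1 / 2) (hη : 0 < η) (hs : 0 < s)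
    (hCρ : 0 < Cρ) :
    ∃ C CS : ℝ, 0 < C ∧ 0 < CS ∧ ∀ (U : lp (fun _ : K => 𝕜) 2) (G ε L : ℝ), U ≠ 0 → ‖U‖ ≤ G →
      (∀ N : ℕ, ∃ S : Finset K, S.card ≤ N ∧
        ‖U - trunc S U‖ ≤ 2 * (G * Real.exp (-(η * (N : ℝ) ^ s)))) →
      0 < ε → ε < 1 → L = Real.log (CS * (G / ‖A U‖) / ε) →
      ∀ (n : ℕ) (Λ : ℕ → Finset K) (W : ℕ → lp (fun _ : K => 𝕜) 2), Λ 0 = ∅ → W 0 = 0 →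
      (∀ k ≤ n, IsSparseStep A C₀ (Cρ * (1 - Real.log ε)) U (Λ k) (W k) (Λ (k + 1)) (W (k + 1))) →
      (∀ k < n, ε * ‖A U‖ < ‖A (U - W (k + 1))‖) →
      1 ≤ L ∧ (n : ℝ) + 1 ≤ C * L ∧
        ∀ k ≤ n + 1, ((Λ k).card : ℝ) ≤ C * L ^ (s⁻¹ + 3 * d + 1) := by
  have hm := hA.m_pos
  have hM := hA.M_pos
  obtain ⟨C₁, CS, hC₁, hCS, hmark⟩ := exists_sparse_support_residual hd hA ha hdecay hC₀ hη hs
  set q := 1 - m / (2 * M) with hq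
  have hq1 : q < 1 := by
    have : 0 < m / (2 * M) := by positivity
    linarith
  have hq0 : 0 < q := by
    have : m / (2 * M) ≤ 1 / 2 := by
      rw [div_le_iff₀ (by positivity)]; linarith [hA.m_le_M]
    linarith
  have hlq : 0 < -Real.log q := neg_pos.2 (Real.log_neg hq0 hq1)
  set C₂ := (Real.log (M / m) + 2) / (-Real.log q) + 1 with hC₂
  have hMm : 0 ≤ Real.log (M / m) := Real.log_nonneg ((one_le_div hm).2 hA.m_le_M)
  have hC₂0 : 0 < C₂ := by positivity
  refine ⟨C₂ * (C₁ * (2 * Cρ + 1) ^ d) + C₂, CS, by positivity, hCS, ?_⟩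
  intro U G ε L hU hUG hG hε hε1 hL n Λ W hΛ0 hW0 hstep hcont
  obtain ⟨hεL, hmark'⟩ := hmark U G ε L hU hUG hG hε hε1 hL
  have hlε : Real.log ε < 0 := Real.log_neg hε hε1
  have hL1 : 1 ≤ L := by linarith
  have hφ : 0 < ‖A U‖ := (mul_pos hm (norm_pos_iff.2 hU)).trans_le (hA.norm_le_apply U)
  have hgal : ∀ k ≤ n + 1, IsGalerkinSeq A (Λ k) U (W k) := by
    intro k hk
    cases k with
    | zero => rw [hΛ0, hW0]; exact ⟨trunc_zero _, by simp [trunc]⟩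
    | succ k =>
      obtain ⟨S, -, -, -, -, -, h⟩ := hstep k (by omega)
      exact h
  have hres : ∀ k ≤ n, ε * ‖A U‖ ≤ ‖A (U - W k)‖ := by
    intro k hk
    cases k with
    | zero => rw [hW0, sub_zero]; exact mul_le_of_le_one_left hφ.le hε1.le
    | succ k => exact (hcont k (by omega)).le
  have henergy : ∀ k ≤ n + 1, energy A (U - W k) ≤ q ^ k * energy A U := by
    intro k
    induction k with
    | zero => intro _; simp [hW0]
    | succ k ih =>
      intro hk
      have h1 := (hstep k (by omega)).energy_le hA hC₀M hU (hgal k (by omega))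
      calc energy A (U - W (k + 1)) ≤ q * energy A (U - W k) := h1
        _ ≤ q * (q ^ k * energy A U) := by gcongr; exact ih (by omega)
        _ = _ := by ring
  have hnL : (n : ℝ) + 1 ≤ C₂ * L := by
    -- The iterate entering the last pass still has a residual of at least ε‖A U‖, while its energy
    -- is at most q^n times the initial one; taking logarithms bounds n.
    have h1 : (ε * ‖A U‖) ^ 2 ≤ M / m * q ^ n * ‖A U‖ ^ 2 := by
      calc (ε * ‖A U‖) ^ 2 ≤ ‖A (U - W n)‖ ^ 2 := by gcongr; exact hres n le_rfl
        _ ≤ M * energy A (U - W n) := hA.norm_apply_sq_le _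
        _ ≤ M * (q ^ n * energy A U) := by gcongr; exact henergy n (by omega)
        _ = M / m * q ^ n * (m * energy A U) := by field_simp
        _ ≤ _ := by gcongr; exact hA.mul_energy_le U
    rw [mul_pow] at h1
    have h2 := le_of_mul_le_mul_right h1 (by positivity)
    have h3 := Real.log_le_log (by positivity) h2
    rw [Real.log_mul (by positivity) (by positivity), Real.log_pow, Real.log_pow] at h3
    push_cast at h3
    have h4 : (n : ℝ) * (-Real.log q) ≤ (Real.log (M / m) + 2) * L := by
      have : Real.log (M / m) ≤ Real.log (M / m) * L := le_mul_of_one_le_right hMm hL1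
      linarith
    have h5 : (n : ℝ) ≤ (Real.log (M / m) + 2) / (-Real.log q) * L := by
      rw [div_mul_eq_mul_div, le_div_iff₀ hlq]; exact h4
    rw [hC₂]
    linarith
  have hbase : 1 ≤ 1 - Real.log ε := by linarith
  set b := C₁ * L ^ (s⁻¹ + 2 * d) with hb
  have hb0 : 0 ≤ b := by positivity
  set ρ := Cρ * (1 - Real.log ε) with hρ
  have hρ0 : 0 ≤ ρ := by positivity
  have hcard : ∀ k ≤ n + 1, ((Λ k).card : ℝ) ≤ k * (b * (2 * ρ + 1) ^ d) := by
    intro k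
    induction k with
    | zero => intro _; simp [hΛ0]
    | succ k ih =>
      intro hk
      obtain ⟨S, hS, hSb⟩ := hmark' (Λ k) (W k) (hgal k (by omega))
      have h1 := (hstep k (by omega)).card_le hρ0 (S := S) (by
        have h2 := hres k (by omega)
        -- The tolerance of the sparse support is below the dynamic marking tolerance C₀‖r‖²/‖f‖, as
        -- ‖r‖ ≥ ε‖f‖.
        have h3 : C₀ * ε ^ 2 * ‖A U‖ ≤ C₀ * (‖A (U - W k)‖ * ‖A (U - W k)‖ / ‖A U‖) := by
          calc C₀ * ε ^ 2 * ‖A U‖ = C₀ * ((ε * ‖A U‖) * (ε * ‖A U‖) / ‖A U‖) := by field_simp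
            _ ≤ _ := by gcongr
        calc _ ≤ (C₀ * (‖A (U - W k)‖ * ‖A (U - W k)‖ / ‖A U‖)) ^ 2 := by
              gcongr; exact hS.trans h3
          _ = _ := by ring) hSb
      have h2 := ih (by omega)
      push_cast
      linarith
  refine ⟨hL1, hnL.trans (by gcongr; exact le_add_of_nonneg_left (by positivity)), ?_⟩
  intro k hk
  have hkn : (k : ℝ) ≤ C₂ * L := by
    refine le_trans ?_ hnL
    exact_mod_cast hk
  have hrad : 2 * ρ + 1 ≤ (2 * Cρ + 1) * L := by
    have : ρ ≤ Cρ * L := by rw [hρ]; gcongr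
    linarith
  calc ((Λ k).card : ℝ) ≤ k * (b * (2 * ρ + 1) ^ d) := hcard k hk
    _ ≤ C₂ * L * (b * ((2 * Cρ + 1) * L) ^ d) := by gcongr
    -- Marked indices, enrichment and passes contribute the three powers of L.
    _ = C₂ * (C₁ * (2 * Cρ + 1) ^ d) * (L ^ (s⁻¹ + 2 * d) * L ^ d * L) := by
      rw [hb, mul_pow _ L]; ring
    _ = C₂ * (C₁ * (2 * Cρ + 1) ^ d) * L ^ (s⁻¹ + 3 * d + 1) := by
      rw [← Real.rpow_natCast L d, ← Real.rpow_add (by positivity),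
        ← Real.rpow_add_one (by positivity)]
      congr 2
      ring
    _ ≤ _ := by gcongr; exact le_add_of_nonneg_right hC₂0.le

end Marking

/-! ### The problem in terms of coefficient sequences -/

section Coefficients

variable {d : ℕ} {𝕜 : Type} [RCLike 𝕜] {K : Set (Fin d → ℤ)}

namespace RieszBasis

variable {V : Type} [NormedAddCommGroup V] [NormedSpace 𝕜 V] (B : RieszBasis 𝕜 K V)

theorem sqrt_weight_ne_zero (k : K) : ((√(B.weight k) : ℝ) : 𝕜) ≠ 0 :=
  RCLike.ofReal_ne_zero.2 (Real.sqrt_pos.2 (B.weight_pos k)).ne'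

theorem φ_eq (k : K) :
    B.φ k = ((√(B.weight k) : ℝ) : 𝕜) • B.repr.symm (lp.single 2 k (1 : 𝕜)) := by
  apply B.repr.injective
  rw [B.repr_φ, map_smul, ContinuousLinearEquiv.apply_symm_apply, ← lp.single_smul]
  simp

theorem repr_coeff_smul_φ (v : V) (k : K) :
    B.repr (B.coeff v k • B.φ k) = lp.single 2 k (B.repr v k) := by
  rw [map_smul, B.repr_φ, ← lp.single_smul, coeff, smul_eq_mul,
    div_mul_cancel₀ _ (B.sqrt_weight_ne_zero k)]

theorem repr_proj (Λ : Finset K) (v : V) : B.repr (B.proj Λ v) = trunc Λ (B.repr v) := by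
  simp only [proj, map_sum, repr_coeff_smul_φ, trunc]

theorem phiNorm_sub_proj (Λ : Finset K) (v : V) :
    B.phiNorm (v - B.proj Λ v) = ‖B.repr v - trunc Λ (B.repr v)‖ := by
  rw [phiNorm, map_sub, repr_proj]

theorem trunc_repr_of_mem_subspace {Λ : Finset K} {w : V} (hw : w ∈ B.subspace Λ) :
    trunc Λ (B.repr w) = B.repr w := by
  induction hw using Submodule.span_induction with
  | mem x hx =>
    obtain ⟨k, hk, rfl⟩ := hx
    rw [B.repr_φ]
    ext l
    rw [trunc_apply]
    split_ifs with hl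
    · rfl
    · rw [lp.single_apply_ne]
      rintro rfl
      exact hl hk
  | zero => rw [map_zero, trunc_zero]
  | add x y _ _ hx hy => rw [map_add, trunc_add, hx, hy]
  | smul c x _ hx => rw [map_smul, trunc_smul, hx]

theorem βHi_pos [Nontrivial V] : 0 < B.βHi := by
  obtain ⟨v, hv⟩ := exists_ne (0 : V)
  have h1 := (B.le_repr v).trans (B.repr_le v)
  have hv' := norm_pos_iff.2 hv
  exact B.βLo_pos.trans_le (le_of_mul_le_mul_right h1 hv')

theorem dualNorm_eq_norm {g : V → 𝕜} {x : lp (fun _ : K => 𝕜) 2}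
    (h : ∀ k, B.dualCoeff g k = x k) : B.dualNorm g = ‖x‖ := by
  have h1 := lp.norm_rpow_eq_tsum (p := 2) (by norm_num) x
  simp only [ENNReal.toReal_ofNat, Real.rpow_ofNat] at h1
  rw [dualNorm]
  simp only [h]
  rw [← h1, Real.sqrt_sq (norm_nonneg _)]

theorem gevreyTerm_le_gevreyNorm {η t : ℝ} {v : V} (hv : B.MemGevrey η t v) (N : ℕ) :
    B.gevreyTerm η t v N ≤ B.gevreyNorm η t v :=
  le_ciSup hv N

theorem norm_repr_le_gevreyNorm (hd : 1 ≤ d) {η t : ℝ} (ht : 0 < t) {v : V}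
    (hv : B.MemGevrey η t v) : ‖B.repr v‖ ≤ B.gevreyNorm η t v := by
  have hd' : (0 : ℝ) < d := by exact_mod_cast hd
  refine le_trans ?_ (B.gevreyTerm_le_gevreyNorm hv 0)
  have h0 : ((0 : ℕ) : ℝ) ^ (t / (d : ℝ)) = 0 := by
    rw [Nat.cast_zero, Real.zero_rpow (div_pos ht hd').ne']
  rw [gevreyTerm, h0, mul_zero, Real.exp_zero, mul_one, bestError]
  have : Nonempty {Λ : Finset K // Λ.card = 0} := ⟨⟨∅, Finset.card_empty⟩⟩
  refine le_ciInf fun Λ => ?_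
  rw [phiNorm_sub_proj, Finset.card_eq_zero.1 Λ.2]
  simp [trunc]

/-- The factor 2 is slack for an infimum that need not be attained. -/
theorem exists_approx_of_memGevrey (hd : 1 ≤ d) {η t : ℝ} (ht : 0 < t) {v : V}
    (hv : B.MemGevrey η t v) (hv0 : v ≠ 0) (N : ℕ) :
    ∃ S : Finset K, S.card ≤ N ∧ ‖B.repr v - trunc S (B.repr v)‖ ≤
      2 * (B.gevreyNorm η t v * Real.exp
        (-(η * unitBallVolume d ^ (-(t / (d : ℝ))) * (N : ℝ) ^ (t / (d : ℝ))))) := by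
  have hG : 0 < B.gevreyNorm η t v :=
    (norm_pos_iff.2 ((map_ne_zero_iff _ B.repr.injective).2 hv0)).trans_le
      (B.norm_repr_le_gevreyNorm hd ht hv)
  by_cases hne : Nonempty {Λ : Finset K // Λ.card = N}
  · have h1 := B.gevreyTerm_le_gevreyNorm hv N
    rw [gevreyTerm, ← le_div_iff₀ (Real.exp_pos _), div_eq_mul_inv, ← Real.exp_neg] at h1
    have h2 := mul_pos hG (Real.exp_pos
      (-(η * unitBallVolume d ^ (-(t / (d : ℝ))) * (N : ℝ) ^ (t / (d : ℝ)))))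
    obtain ⟨Λ, hΛ⟩ := exists_lt_of_ciInf_lt (h1.trans_lt (lt_two_mul_self h2))
    refine ⟨Λ.1, Λ.2.le, ?_⟩
    rw [← phiNorm_sub_proj]
    exact hΛ.le
  -- With no N-element subset, `bestError` is the default infimum 0 and says nothing; but then the
  -- whole index set has fewer than N elements and the error vanishes.
  · have hfin : Finite K := by
      by_contra hinf
      rw [not_finite_iff_infinite] at hinf
      obtain ⟨Λ, hΛ⟩ := Infinite.exists_subset_card_eq K N
      exact hne ⟨⟨Λ, hΛ⟩⟩
    have := Fintype.ofFinite K
    refine ⟨Finset.univ, ?_, ?_⟩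
    · by_contra hcon
      obtain ⟨Λ, -, hΛ⟩ := Finset.exists_subset_card_eq (not_le.1 hcon).le
      exact hne ⟨⟨Λ, hΛ⟩⟩
    · have : trunc Finset.univ (B.repr v) = B.repr v := by
        ext k
        simp [trunc_apply]
      rw [this, sub_self, norm_zero]
      positivity

end RieszBasis

theorem unitBallVolume_pos (d : ℕ) : 0 < unitBallVolume d :=
  ENNReal.toReal_pos (Metric.measure_ball_pos _ _ one_pos).ne' measure_ball_lt_top.ne

theorem exists_operator_of_sesquilinear {E : Type*} [NormedAddCommGroup E] [InnerProductSpace 𝕜 E]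
    [CompleteSpace E] (a : E → E → 𝕜) (h_add_left : ∀ x x' y, a (x + x') y = a x y + a x' y)
    (h_smul_left : ∀ (c : 𝕜) x y, a (c • x) y = conj c * a x y)
    (h_add_right : ∀ x y y', a x (y + y') = a x y + a x y')
    (h_smul_right : ∀ (c : 𝕜) x y, a x (c • y) = c * a x y)
    (h_bound : ∃ C : ℝ, ∀ x y, ‖a x y‖ ≤ C * ‖x‖ * ‖y‖) :
    ∃ A : E →L[𝕜] E, ∀ x y, inner 𝕜 (A x) y = a x y := by
  obtain ⟨C, hC⟩ := h_bound
  refine ⟨InnerProductSpace.continuousLinearMapOfBilin (LinearMap.mkContinuous₂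
    (LinearMap.mk₂'ₛₗ (starRingEnd 𝕜) (RingHom.id 𝕜) a h_add_left h_smul_left h_add_right
      h_smul_right) C hC), fun x y => ?_⟩
  rw [InnerProductSpace.continuousLinearMapOfBilin_apply]
  rfl

/-! ### The stiffness operator and the residual. -/

variable (P : EllipticProblem d) (B : RieszBasis 𝕜 K (P.V 𝕜))

theorem exists_norm_form_repr_symm_le : ∃ C : ℝ, ∀ x y : lp (fun _ : K => 𝕜) 2,
    ‖P.form (B.repr.symm y) (B.repr.symm x)‖ ≤ C * ‖x‖ * ‖y‖ := by
  have hLo := B.βLo_pos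
  have hα := P.αHi_pos
  have h : ∀ x : lp (fun _ : K => 𝕜) 2, ‖B.repr.symm x‖ ≤ ‖x‖ / B.βLo := by
    intro x
    have := B.le_repr (B.repr.symm x)
    rw [ContinuousLinearEquiv.apply_symm_apply] at this
    rwa [le_div_iff₀ hLo, mul_comm]
  refine ⟨P.αHi / B.βLo ^ 2, fun x y => (P.norm_form_le _ _).trans ?_⟩
  calc P.αHi * ‖B.repr.symm y‖ * ‖B.repr.symm x‖
      ≤ P.αHi * (‖y‖ / B.βLo) * (‖x‖ / B.βLo) := by
        gcongr
        · exact h y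
        · exact h x
    _ = _ := by ring

/-- The slots are exchanged because `form` is conjugate linear in its second argument and `inner` in
its first. -/
theorem exists_stiffnessOp : ∃ A : lp (fun _ : K => 𝕜) 2 →L[𝕜] lp (fun _ : K => 𝕜) 2,
    ∀ x y, inner 𝕜 (A x) y = P.form (B.repr.symm y) (B.repr.symm x) :=
  exists_operator_of_sesquilinear
    (fun x y : lp (fun _ : K => 𝕜) 2 => P.form (B.repr.symm y) (B.repr.symm x))
    (fun x x' y => by rw [map_add, P.form_add_right])
    (fun c x y => by rw [map_smul, P.form_smul_right])
    (fun x y y' => by rw [map_add, P.form_add_left])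
    (fun c x y => by rw [map_smul, P.form_smul_left])
    (exists_norm_form_repr_symm_le P B)

/-- The operator on `ℓ²` whose matrix is the stiffness matrix. -/
def stiffnessOp : lp (fun _ : K => 𝕜) 2 →L[𝕜] lp (fun _ : K => 𝕜) 2 :=
  (exists_stiffnessOp P B).choose

theorem inner_stiffnessOp_left (x y : lp (fun _ : K => 𝕜) 2) :
    inner 𝕜 (stiffnessOp P B x) y = P.form (B.repr.symm y) (B.repr.symm x) :=
  (exists_stiffnessOp P B).choose_spec x y

theorem inner_stiffnessOp (x y : lp (fun _ : K => 𝕜) 2) :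
    inner 𝕜 x (stiffnessOp P B y) = P.form (B.repr.symm y) (B.repr.symm x) := by
  rw [← inner_conj_symm, inner_stiffnessOp_left, P.conj_form]

theorem stiffnessOp_apply (x : lp (fun _ : K => 𝕜) 2) (k : K) :
    stiffnessOp P B x k = P.form (B.repr.symm x) (B.repr.symm (lp.single 2 k (1 : 𝕜))) := by
  rw [← inner_stiffnessOp, lp.inner_single_left]
  simp

theorem stiffnessOp_single (l k : K) :
    stiffnessOp P B (lp.single 2 k 1) l = stiffness P B l k := by
  rw [stiffnessOp_apply, stiffness, B.φ_eq, B.φ_eq, P.form_smul_left, P.form_smul_right,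
    RCLike.conj_ofReal]
  have h1 := B.sqrt_weight_ne_zero k
  have h2 := B.sqrt_weight_ne_zero l
  push_cast
  field_simp

theorem dualCoeff_form (v : P.V 𝕜) (k : K) :
    B.dualCoeff (fun z => P.form v z) k = stiffnessOp P B (B.repr v) k := by
  rw [stiffnessOp_apply, RieszBasis.dualCoeff, B.φ_eq, P.form_smul_right, RCLike.conj_ofReal,
    mul_div_cancel_left₀ _ (B.sqrt_weight_ne_zero k), ContinuousLinearEquiv.symm_apply_apply]

theorem isElliptic_stiffnessOp [Nontrivial (P.V 𝕜)] :
    IsElliptic (stiffnessOp P B) (P.αLo / B.βHi ^ 2) (P.αHi / B.βLo ^ 2) := by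
  have hLo := B.βLo_pos
  have hHi := B.βHi_pos
  have hα := P.αLo_pos
  have hα' := P.αHi_pos
  have key : ∀ x, P.αLo / B.βHi ^ 2 * ‖x‖ ^ 2 ≤ RCLike.re (inner 𝕜 x (stiffnessOp P B x)) ∧
      RCLike.re (inner 𝕜 x (stiffnessOp P B x)) ≤ P.αHi / B.βLo ^ 2 * ‖x‖ ^ 2 := by
    intro x
    rw [inner_stiffnessOp]
    have h1 := B.le_repr (B.repr.symm x)
    have h2 := B.repr_le (B.repr.symm x)
    rw [ContinuousLinearEquiv.apply_symm_apply] at h1 h2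
    obtain ⟨h3, h4⟩ := P.re_form_self_bounds (B.repr.symm x)
    constructor
    · calc P.αLo / B.βHi ^ 2 * ‖x‖ ^ 2 ≤ P.αLo / B.βHi ^ 2 * (B.βHi * ‖B.repr.symm x‖) ^ 2 := by
            gcongr
        _ = P.αLo * ‖B.repr.symm x‖ ^ 2 := by field_simp
        _ ≤ _ := h3
    · calc _ ≤ P.αHi * ‖B.repr.symm x‖ ^ 2 := h4
        _ = P.αHi / B.βLo ^ 2 * (B.βLo * ‖B.repr.symm x‖) ^ 2 := by field_simp
        _ ≤ P.αHi / B.βLo ^ 2 * ‖x‖ ^ 2 := by gcongr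
  refine ⟨fun x y => ?_, by positivity, ?_, fun x => (key x).1, fun x => (key x).2⟩
  · rw [inner_stiffnessOp_left, inner_stiffnessOp]
  -- m ≤ M follows by testing the two bounds on one nonzero vector.
  · obtain ⟨v, hv⟩ := exists_ne (0 : P.V 𝕜)
    have hx : 0 < ‖B.repr v‖ := norm_pos_iff.2 ((map_ne_zero_iff _ B.repr.injective).2 hv)
    exact le_of_mul_le_mul_right ((key _).1.trans (key _).2) (by positivity : 0 < ‖B.repr v‖ ^ 2)

theorem energy_stiffnessOp (v : P.V 𝕜) :
    P.energyNorm v = √(energy (stiffnessOp P B) (B.repr v)) := by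
  rw [energy, inner_stiffnessOp, ContinuousLinearEquiv.symm_apply_apply]
  rfl

variable {P}

theorem residual_eq {f : P.V 𝕜 →L⋆[𝕜] 𝕜} {u : P.V 𝕜} (hu : P.IsWeakSolution f u) (w : P.V 𝕜) :
    P.residual f w = fun z => P.form (u - w) z := by
  ext z
  rw [EllipticProblem.residual, P.form_sub_left, hu z]

theorem dualCoeff_residual {f : P.V 𝕜 →L⋆[𝕜] 𝕜} {u : P.V 𝕜} (hu : P.IsWeakSolution f u)
    (w : P.V 𝕜) (k : K) :
    B.dualCoeff (P.residual f w) k = stiffnessOp P B (B.repr u - B.repr w) k := by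
  rw [residual_eq hu, dualCoeff_form, map_sub]

theorem dualNorm_residual {f : P.V 𝕜 →L⋆[𝕜] 𝕜} {u : P.V 𝕜} (hu : P.IsWeakSolution f u)
    (w : P.V 𝕜) :
    B.dualNorm (P.residual f w) = ‖stiffnessOp P B (B.repr u - B.repr w)‖ :=
  B.dualNorm_eq_norm (dualCoeff_residual B hu w)

theorem dualNorm_rhs {f : P.V 𝕜 →L⋆[𝕜] 𝕜} {u : P.V 𝕜} (hu : P.IsWeakSolution f u) :
    B.dualNorm f = ‖stiffnessOp P B (B.repr u)‖ := by
  have : (f : P.V 𝕜 → 𝕜) = fun z => P.form u z := funext fun z => (hu z).symm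
  rw [this]
  exact B.dualNorm_eq_norm (dualCoeff_form P B u)

theorem isGalerkinSeq_of_isGalerkin {f : P.V 𝕜 →L⋆[𝕜] 𝕜} {u : P.V 𝕜} (hu : P.IsWeakSolution f u)
    {Λ : Finset K} {w : P.V 𝕜} (hw : IsGalerkin P B f Λ w) :
    IsGalerkinSeq (stiffnessOp P B) Λ (B.repr u) (B.repr w) := by
  refine ⟨B.trunc_repr_of_mem_subspace hw.1, ?_⟩
  ext k
  rw [trunc_apply]
  split_ifs with hk
  · rw [← dualCoeff_residual B hu, RieszBasis.dualCoeff, EllipticProblem.residual,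
      hw.2 _ (Submodule.subset_span ⟨k, hk, rfl⟩), sub_self, zero_div]
    rfl
  · rfl

theorem energyNorm_sub_le [Nontrivial (P.V 𝕜)] {f : P.V 𝕜 →L⋆[𝕜] 𝕜} {u : P.V 𝕜}
    (hu : P.IsWeakSolution f u) (w : P.V 𝕜) :
    P.energyNorm (u - w) ≤ B.βHi / √P.αLo * B.dualNorm (P.residual f w) := by
  have hA := isElliptic_stiffnessOp P B
  have hHi := B.βHi_pos
  have hα := P.αLo_pos
  rw [energy_stiffnessOp P B, dualNorm_residual B hu, map_sub]
  refine Real.sqrt_le_iff.2 ⟨by positivity, ?_⟩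
  rw [mul_pow, div_pow, Real.sq_sqrt hα.le]
  have h1 := hA.mul_energy_le (B.repr u - B.repr w)
  calc energy (stiffnessOp P B) (B.repr u - B.repr w)
      = B.βHi ^ 2 / P.αLo *
        (P.αLo / B.βHi ^ 2 * energy (stiffnessOp P B) (B.repr u - B.repr w)) := by field_simp
    _ ≤ _ := by gcongr

/-! ### The algorithm in coefficient space. -/

variable {p : Params}

/-- The bound on C₀ is one quarter of √(m/M), so the product is even at most 1/16. -/
theorem Params.Admissible.C₀_sq_mul_le [Nontrivial (P.V 𝕜)] (hp : p.Admissible P B) :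
    p.C₀ ^ 2 * ((P.αHi / B.βLo ^ 2) / (P.αLo / B.βHi ^ 2)) ≤ 1 / 2 := by
  have hHi := B.βHi_pos
  have hLo := B.βLo_pos
  have hα := P.αLo_pos
  have hα' := P.αHi_pos
  have hC := hp.C₀_pos
  have h1 : p.C₀ ^ 2 ≤ (1 / 4 * √(P.αLo / P.αHi) * (B.βLo / B.βHi)) ^ 2 := by
    gcongr
    exact hp.C₀_le
  rw [mul_pow, mul_pow, Real.sq_sqrt (by positivity)] at h1
  calc _ ≤ ((1 / 4) ^ 2 * (P.αLo / P.αHi) * (B.βLo / B.βHi) ^ 2) *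
        ((P.αHi / B.βLo ^ 2) / (P.αLo / B.βHi ^ 2)) := by gcongr
    _ = 1 / 16 := by field_simp; norm_num
    _ ≤ _ := by norm_num

/-- While the residual is at least ε‖f‖, 1 - θ² ≥ C₀²ε², so the radius is logarithmic in ε; the
rounding δ < 1 costs one more unit. -/
theorem exists_minRadius_le (P : EllipticProblem d) (hC₀ : 0 < p.C₀) (hCinv : 0 < p.Cinv)
    (hηinv : 0 < p.ηinv) :
    ∃ C : ℝ, 0 < C ∧ ∀ ε θ : ℝ, 0 < ε → ε < 1 → p.C₀ ^ 2 * ε ^ 2 ≤ 1 - θ ^ 2 →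
      ∀ δ : ℝ, δ < 1 → minRadius P p θ + δ ≤ C * (1 - Real.log ε) := by
  have hα := P.αLo_pos
  have hα' := P.αHi_pos
  set κ := p.C₀ / √(P.αLo * P.αHi) / p.Cinv with hκ
  have hκ0 : 0 < κ := by positivity
  refine ⟨1 / p.ηinv * (|Real.log κ| + 1) + 1, by positivity, fun ε θ hε hε1 hθ δ hδ => ?_⟩
  have hl : Real.log ε < 0 := Real.log_neg hε hε1
  have h1 : κ * ε ≤ √((1 - θ ^ 2) / (P.αLo * P.αHi)) / p.Cinv := by
    have : κ * ε = √(p.C₀ ^ 2 * ε ^ 2 / (P.αLo * P.αHi)) / p.Cinv := by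
      rw [Real.sqrt_div (by positivity), ← mul_pow, Real.sqrt_sq (by positivity), hκ]
      ring
    rw [this]
    gcongr
  have h2 := Real.log_le_log (by positivity) h1
  rw [Real.log_mul hκ0.ne' hε.ne'] at h2
  have h3 : minRadius P p θ ≤ 1 / p.ηinv * (|Real.log κ| + 1) * (1 - Real.log ε) := by
    rw [minRadius]
    refine max_le ?_ ?_
    · exact mul_nonneg (by positivity) (by linarith)
    · have h4 := neg_abs_le (Real.log κ)
      have h5 : -Real.log (√((1 - θ ^ 2) / (P.αLo * P.αHi)) / p.Cinv) ≤
          (|Real.log κ| + 1) * (1 - Real.log ε) := by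
        nlinarith [abs_nonneg (Real.log κ)]
      rw [neg_mul, ← mul_neg, mul_assoc]
      gcongr
  linarith

theorem bulkCriterion_residual_iff {f : P.V 𝕜 →L⋆[𝕜] 𝕜} {u : P.V 𝕜} (hu : P.IsWeakSolution f u)
    (w : P.V 𝕜) (θ : ℝ) (S : Finset K) : BulkCriterion P B (P.residual f w) θ S ↔
      θ ^ 2 * ‖stiffnessOp P B (B.repr u - B.repr w)‖ ^ 2 ≤
        ‖trunc S (stiffnessOp P B (B.repr u - B.repr w))‖ ^ 2 := by
  have h : ∑ k ∈ S, ‖B.dualCoeff (P.residual f w) k‖ ^ 2 =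
      ∑ k ∈ S, ‖stiffnessOp P B (B.repr u - B.repr w) k‖ ^ 2 :=
    Finset.sum_congr rfl fun k _ => by rw [dualCoeff_residual B hu]
  rw [BulkCriterion, dualNorm_residual B hu, norm_sq_trunc, h]

/-- The radicand in `theta` is nonnegative for Galerkin iterates, so the square root never takes its
default value 0 at a negative argument. -/
theorem theta_sq [Nontrivial (P.V 𝕜)] (hp : p.Admissible P B) {f : P.V 𝕜 →L⋆[𝕜] 𝕜} {u : P.V 𝕜}
    (hu : P.IsWeakSolution f u) {Λ : Finset K} {w : P.V 𝕜}
    (hw : IsGalerkinSeq (stiffnessOp P B) Λ (B.repr u) (B.repr w)) :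
    theta P B p f w ^ 2 = 1 - p.C₀ ^ 2 * ‖stiffnessOp P B (B.repr u - B.repr w)‖ ^ 2 /
      ‖stiffnessOp P B (B.repr u)‖ ^ 2 := by
  have h1 := norm_apply_sub_sq_le (isElliptic_stiffnessOp P B) hw
  have h2 := hp.C₀_sq_mul_le
  rw [theta, dualNorm_residual B hu, dualNorm_rhs B hu, Real.sq_sqrt]
  generalize (P.αHi / B.βLo ^ 2) / (P.αLo / B.βHi ^ 2) = κ at h1 h2
  generalize ‖stiffnessOp P B (B.repr u - B.repr w)‖ = r at *
  generalize ‖stiffnessOp P B (B.repr u)‖ = b at *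
  refine sub_nonneg.2 (div_le_one_of_le₀ ?_ (sq_nonneg b))
  have h3 := mul_le_mul_of_nonneg_left h1 (sq_nonneg p.C₀)
  nlinarith [sq_nonneg b]

theorem isSparseStep_of_isStep [Nontrivial (P.V 𝕜)] (hp : p.Admissible P B)
    {f : P.V 𝕜 →L⋆[𝕜] 𝕜} {u : P.V 𝕜} (hu : P.IsWeakSolution f u) (hu0 : u ≠ 0) {ε ρ : ℝ}
    (hρ : ∀ θ : ℝ, p.C₀ ^ 2 * ε ^ 2 ≤ 1 - θ ^ 2 → ∀ δ : ℝ, δ < 1 → minRadius P p θ + δ ≤ ρ)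
    (hε : 0 < ε) {Λ Λ' : Finset K} {w w' : P.V 𝕜}
    (hw : IsGalerkinSeq (stiffnessOp P B) Λ (B.repr u) (B.repr w))
    (hres : ε * B.dualNorm f ≤ B.dualNorm (P.residual f w)) (h : IsStep P B p f Λ w Λ' w') :
    IsSparseStep (stiffnessOp P B) p.C₀ ρ (B.repr u) Λ (B.repr w) Λ' (B.repr w') := by
  obtain ⟨S, δ, ⟨hbulk, hmin⟩, hδ0, hδ1, hΛ', hw'⟩ := h
  have hA := isElliptic_stiffnessOp P B
  have hφ : 0 < ‖stiffnessOp P B (B.repr u)‖ :=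
    (mul_pos hA.m_pos (norm_pos_iff.2 ((map_ne_zero_iff _ B.repr.injective).2 hu0))).trans_le
      (hA.norm_le_apply _)
  rw [dualNorm_residual B hu, dualNorm_rhs B hu] at hres
  have hθ := theta_sq B hp hu hw
  have hradius : minRadius P p (theta P B p f w) + δ ≤ ρ := by
    refine hρ _ ?_ δ hδ1
    rw [hθ, sub_sub_cancel]
    generalize ‖stiffnessOp P B (B.repr u - B.repr w)‖ = r at *
    generalize ‖stiffnessOp P B (B.repr u)‖ = b at *
    rw [le_div_iff₀ (by positivity)]
    calc p.C₀ ^ 2 * ε ^ 2 * b ^ 2 = p.C₀ ^ 2 * (ε * b) ^ 2 := by ring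
      _ ≤ _ := by gcongr
  simp only [bulkCriterion_residual_iff B hu, hθ] at hbulk hmin
  refine ⟨S, hbulk, hmin, fun k hk => ?_, fun k hk => (hΛ' k).2 (Or.inl hk), fun k hk => ?_,
    isGalerkinSeq_of_isGalerkin B hu hw'⟩
  · refine (hΛ' k).2 (Or.inr ⟨k, hk, ?_⟩)
    rw [latticeDist_self]
    exact add_nonneg (le_max_left _ _) hδ0
  · exact ((hΛ' k).1 hk).imp_right fun ⟨l, hl, hkl⟩ => ⟨l, hl, hkl.trans hradius⟩

/-- The numbers of passes and of active degrees of freedom grow at most polynomially in the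
logarithm of the reciprocal of the tolerance. -/
theorem exists_isRun_bounds [Nontrivial (P.V 𝕜)] (hd : 1 ≤ d) {cL ηL : ℝ} (hηL : 0 < ηL)
    (hA : ExpDecay cL ηL (stiffness P B)) (hp : p.Admissible P B) {η t : ℝ} (hη : 0 < η)
    (ht : 0 < t) :
    ∃ C CS : ℝ, 0 < C ∧ 0 < CS ∧ ∀ (f : P.V 𝕜 →L⋆[𝕜] 𝕜) (u : P.V 𝕜) (ε L : ℝ) (n : ℕ)
      (Λ : ℕ → Finset K) (w : ℕ → P.V 𝕜), f ≠ 0 → P.IsWeakSolution f u → B.MemGevrey η t u →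
      0 < ε → ε < 1 → IsRun P B p f ε n Λ w →
      L = Real.log (CS * (B.gevreyNorm η t u / B.dualNorm f) / ε) →
      0 < B.gevreyNorm η t u / B.dualNorm f ∧ 1 ≤ L ∧ (n : ℝ) + 1 ≤ C * L ∧
        ∀ k ≤ n + 1, ((Λ k).card : ℝ) ≤ C * L ^ ((d : ℝ) / t + 3 * d + 1) := by
  have hd' : (0 : ℝ) < d := by exact_mod_cast hd
  obtain ⟨Cρ, hCρ, hrad⟩ := exists_minRadius_le P hp.C₀_pos hp.Cinv_pos hp.ηinv_pos
  have hell := isElliptic_stiffnessOp P B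
  obtain ⟨C, CS, hC, hCS, hbounds⟩ := exists_run_bounds hd hell hηL
    (fun l k => by rw [stiffnessOp_single]; exact hA l k) hp.C₀_pos hp.C₀_sq_mul_le
    (mul_pos hη (Real.rpow_pos_of_pos (unitBallVolume_pos d) (-(t / (d : ℝ))))) (div_pos ht hd') hCρ
  refine ⟨C, CS, hC, hCS, fun f u ε L n Λ w hf hu hG hε hε1 hrun hL => ?_⟩
  have hu0 : u ≠ 0 := by
    rintro rfl
    refine hf (ContinuousLinearMap.ext fun z => ?_)
    have := P.form_smul_left (0 : 𝕜) 0 z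
    rw [smul_zero, zero_mul] at this
    rw [← hu z, this]
    rfl
  have hU0 : B.repr u ≠ 0 := (map_ne_zero_iff _ B.repr.injective).2 hu0
  have hUG := B.norm_repr_le_gevreyNorm hd ht hG
  have hφ : 0 < ‖stiffnessOp P B (B.repr u)‖ :=
    (mul_pos hell.m_pos (norm_pos_iff.2 hU0)).trans_le (hell.norm_le_apply _)
  have hW0 : B.repr (w 0) = 0 := by rw [hrun.init_iterate, map_zero]
  have hgal : ∀ k ≤ n + 1,
      IsGalerkinSeq (stiffnessOp P B) (Λ k) (B.repr u) (B.repr (w k)) := by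
    intro k hk
    cases k with
    | zero => rw [hrun.init_set, hW0]; exact ⟨trunc_zero _, by simp [trunc]⟩
    | succ k =>
      obtain ⟨S, δ, -, -, -, -, h⟩ := hrun.step k (by omega)
      exact isGalerkinSeq_of_isGalerkin B hu h
  have hres : ∀ k ≤ n, ε * B.dualNorm f ≤ B.dualNorm (P.residual f (w k)) := by
    intro k hk
    cases k with
    | zero =>
      rw [dualNorm_residual B hu, hW0, sub_zero, dualNorm_rhs B hu]
      exact mul_le_of_le_one_left hφ.le hε1.le
    | succ k => exact (hrun.continue_loop k (by omega)).le
  have h := hbounds (B.repr u) (B.gevreyNorm η t u) ε L hU0 hUG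
    (B.exists_approx_of_memGevrey hd ht hG hu0) hε hε1 (by rw [hL, dualNorm_rhs B hu]) n Λ
    (fun k => B.repr (w k)) hrun.init_set hW0
    (fun k hk => isSparseStep_of_isStep B hp hu hu0
      (fun θ hθ δ hδ => hrad ε θ hε hε1 hθ δ hδ) hε (hgal k (by omega)) (hres k hk)
      (hrun.step k hk))
    (fun k hk => by
      rw [← dualNorm_rhs B hu, ← dualNorm_residual B hu]
      exact hrun.continue_loop k hk)
  rw [inv_div] at h
  refine ⟨?_, h⟩
  rw [dualNorm_rhs B hu]
  exact div_pos ((norm_pos_iff.2 hU0).trans_le hUG) hφ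

end Coefficients

/-! ### From powers of the logarithm to the stated bounds. -/

theorem mul_rpow_le_mul_rpow {v C L L' q x : ℝ} (hv : 0 ≤ v) (hL : 0 ≤ L) (hLL' : L ≤ L')
    (hq : 1 ≤ q) (hx : 1 ≤ x) (h : C ≤ v * x) : C * L ^ q ≤ v * (x * L') ^ q := by
  have hx0 : 0 ≤ x := zero_le_one.trans hx
  have h1 : x ≤ x ^ q := by
    calc x = x ^ (1 : ℝ) := (Real.rpow_one x).symm
      _ ≤ x ^ q := Real.rpow_le_rpow_of_exponent_le hx hq
  have h2 : 0 ≤ L ^ q := Real.rpow_nonneg hL q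
  have h3 : 0 ≤ q := zero_le_one.trans hq
  calc C * L ^ q ≤ v * x ^ q * L ^ q := by
        gcongr
        exact h.trans (by gcongr)
    _ = v * (x * L) ^ q := by rw [Real.mul_rpow hx0 hL, mul_assoc]
    _ ≤ _ := by gcongr

theorem workload_le {d : ℕ} {𝕜 : Type} [RCLike 𝕜] {K : Set (Fin d → ℤ)} {P : EllipticProblem d}
    {B : RieszBasis 𝕜 K (P.V 𝕜)} {s : Solver 𝕜 K} {C b : ℝ} (hs : IsLinearCostSolver P B s C)
    {f : P.V 𝕜 →L⋆[𝕜] 𝕜} {n : ℕ} {Λ : ℕ → Finset K}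
    (hb : ∀ k ≤ n + 1, ((Λ k).card : ℝ) ≤ b) :
    workload P B s f n Λ ≤ (n + 1) * ((|C| + 1) * b) := by
  rw [workload]
  have h : ∀ k ∈ Finset.range (n + 1),
      ((s (Λ (k + 1)) fun l => B.dualCoeff f l).cost : ℝ) + (Λ (k + 1)).card ≤ (|C| + 1) * b := by
    intro k hk
    have h1 := (hs (Λ (k + 1)) fun l => B.dualCoeff f l).2
    have h2 : C * ((Λ (k + 1)).card : ℝ) ≤ |C| * (Λ (k + 1)).card := by
      gcongr
      exact le_abs_self C
    have h3 := hb (k + 1) (by simpa using hk)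
    have h4 : (|C| + 1) * ((Λ (k + 1)).card : ℝ) ≤ (|C| + 1) * b := by gcongr
    linarith
  refine (Finset.sum_le_sum h).trans (le_of_eq ?_)
  simp

end DynGal

end

theorem theorem5p1 {d : ℕ} (hd : 1 ≤ d) {𝕜 : Type} [RCLike 𝕜] {K : Set (Fin d → ℤ)}
    (P : DynGal.EllipticProblem d) (B : DynGal.RieszBasis 𝕜 K (P.V 𝕜))
    (cL ηL : ℝ) (hηL : 0 < ηL) (hA : DynGal.ExpDecay cL ηL (DynGal.stiffness P B))
    (p : DynGal.Params) (hp : p.Admissible P B)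
    (η t : ℝ) (hη : 0 < η) (ht : 0 < t) (htd : t ≤ d) :
    ∃ tS ηS CS : ℝ, 0 < tS ∧ tS < t ∧ 0 < ηS ∧ ηS < η ∧ 0 < CS ∧
      (∀ (f : P.V 𝕜 →L⋆[𝕜] 𝕜) (u : P.V 𝕜) (ε : ℝ) (n : ℕ) (Λ : ℕ → Finset K) (w : ℕ → P.V 𝕜),
        f ≠ 0 → P.IsWeakSolution f u → B.MemGevrey η t u → 0 < ε → ε < 1 →
        DynGal.IsRun P B p f ε n Λ w →
          P.energyNorm (u - w (n + 1)) ≤ B.βHi / √P.αLo * B.dualNorm f * ε ∧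
          ((Λ (n + 1)).card : ℝ) ≤ DynGal.unitBallVolume d *
            (1 / ηS * Real.log (CS * (B.gevreyNorm η t u / B.dualNorm f) / ε)) ^ ((d : ℝ) / tS)) ∧
      (∀ Csolve : ℝ, ∃ ηW : ℝ, 0 < ηW ∧ ηW < ηS ∧ ∀ δ : ℝ, 0 < δ → ∃ CW : ℝ, CS < CW ∧
        ∀ (s : DynGal.Solver 𝕜 K) (f : P.V 𝕜 →L⋆[𝕜] 𝕜) (u : P.V 𝕜) (ε : ℝ) (n : ℕ)
          (Λ : ℕ → Finset K) (w : ℕ → P.V 𝕜),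
          DynGal.IsLinearCostSolver P B s Csolve →
          f ≠ 0 → P.IsWeakSolution f u → B.MemGevrey η t u → 0 < ε → ε < 1 →
          δ ≤ |Real.log (|Real.log ε|)| →
          DynGal.IsRun P B p f ε n Λ w →
            DynGal.workload P B s f n Λ ≤ DynGal.unitBallVolume d *
              (1 / ηW * Real.log (CW * (B.gevreyNorm η t u / B.dualNorm f) /
                (ε ^ 4 * |Real.log (|Real.log ε|)|⁻¹))) ^ ((d : ℝ) / tS)) := by
  -- If V is trivial, no f ≠ 0 exists and any admissible constants do; otherwise β^* > 0.
  rcases subsingleton_or_nontrivial (P.V 𝕜) with hV | hV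
  · have hf : ∀ f : P.V 𝕜 →L⋆[𝕜] 𝕜, f = 0 := fun f =>
      ContinuousLinearMap.ext fun z => by rw [Subsingleton.elim z 0, map_zero, map_zero]
    refine ⟨t / 2, η / 2, 1, by linarith, by linarith, by linarith, by linarith, one_pos,
      fun f _ _ _ _ _ h => absurd (hf f) h, fun _ => ⟨η / 4, by linarith, by linarith,
      fun _ _ => ⟨2, by norm_num, fun _ f _ _ _ _ _ _ h => absurd (hf f) h⟩⟩⟩
  have hd' : (0 : ℝ) < d := by exact_mod_cast hd
  obtain ⟨C, CS, hC, hCS, hrun⟩ := DynGal.exists_isRun_bounds B hd hηL hA hp hη ht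
  have hv := DynGal.unitBallVolume_pos d
  generalize DynGal.unitBallVolume d = v at hv ⊢
  -- One more than the exponent of the cardinality, so that the same t_* = d/q also serves the
  -- workload. As q > d/t, t_* < t.
  obtain ⟨q, hq⟩ : ∃ q : ℝ, q = (d : ℝ) / t + 3 * d + 1 + 1 := ⟨_, rfl⟩
  have hdt : 0 < (d : ℝ) / t := by positivity
  have hq1 : 1 ≤ q := by rw [hq]; nlinarith
  have hq0 : 0 < q := by linarith
  have hdq : (d : ℝ) / (d / q) = q := by field_simp
  -- ηS ≤ 1 and ηS ≤ v/C give C ≤ v/ηS ≤ v (1/ηS)^q, which moves the constant C into the rate.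
  obtain ⟨ηS, hηS0, hηSη, hηS1, hηSv⟩ : ∃ ηS : ℝ, 0 < ηS ∧ ηS < η ∧ ηS ≤ 1 ∧ ηS ≤ v / C :=
    ⟨min (η / 2) (min 1 (v / C)), by positivity, (min_le_left _ _).trans_lt (half_lt_self hη),
      (min_le_right _ _).trans (min_le_left _ _), (min_le_right _ _).trans (min_le_right _ _)⟩
  refine ⟨d / q, ηS, CS, by positivity, ?_, hηS0, hηSη, hCS, ?_, ?_⟩
  · rw [div_lt_iff₀ hq0, hq]
    have : t * ((d : ℝ) / t) = d := by field_simp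
    nlinarith [mul_pos ht hd']
  · intro f u ε n Λ w hf hu hG hε hε1 hr
    obtain ⟨-, hL1, -, hcard⟩ := hrun f u ε _ n Λ w hf hu hG hε hε1 hr rfl
    set L := Real.log (CS * (B.gevreyNorm η t u / B.dualNorm f) / ε)
    constructor
    · refine (DynGal.energyNorm_sub_le B hu _).trans ?_
      have h1 := hr.terminate
      have hα := P.αLo_pos
      have hβ := B.βHi_pos
      calc _ ≤ B.βHi / √P.αLo * (ε * B.dualNorm f) := by gcongr
        _ = _ := by ring
    · rw [hdq]
      calc ((Λ (n + 1)).card : ℝ) ≤ C * L ^ ((d : ℝ) / t + 3 * d + 1) := hcard _ le_rfl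
        _ ≤ C * L ^ q := by
          gcongr C * ?_
          exact Real.rpow_le_rpow_of_exponent_le hL1 (by rw [hq]; linarith)
        _ ≤ v * (1 / ηS * L) ^ q := by
          refine DynGal.mul_rpow_le_mul_rpow hv.le (by linarith) le_rfl hq1 ?_ ?_
          · rwa [one_le_div hηS0]
          · rw [mul_one_div, le_div_iff₀ hηS0, mul_comm]
            exact (le_div_iff₀ hC).1 hηSv
  · intro Csolve
    -- Passes, times work and storage per index, times indices.
    obtain ⟨C', hC'⟩ : ∃ C' : ℝ, C' = C * ((|Csolve| + 1) * C) := ⟨_, rfl⟩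
    have hC'0 : 0 < C' := by rw [hC']; positivity
    obtain ⟨ηW, hηW0, hηWS, hηWv⟩ : ∃ ηW : ℝ, 0 < ηW ∧ ηW < ηS ∧ ηW ≤ v / C' :=
      ⟨min (ηS / 2) (v / C'), by positivity, (min_le_left _ _).trans_lt (half_lt_self hηS0),
        min_le_right _ _⟩
    refine ⟨ηW, hηW0, hηWS, fun δ hδ => ⟨max (CS + 1) (CS / δ),
      (lt_add_one CS).trans_le (le_max_left _ _), ?_⟩⟩
    intro s f u ε n Λ w hs hf hu hG hε hε1 hδε hr
    obtain ⟨hg, hL1, hn, hcard⟩ := hrun f u ε _ n Λ w hf hu hG hε hε1 hr rfl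
    have hwork' := DynGal.workload_le (f := f) hs hcard
    generalize DynGal.workload P B s f n Λ = 𝒲 at hwork' ⊢
    generalize B.gevreyNorm η t u / B.dualNorm f = g at *
    generalize |Real.log (|Real.log ε|)| = D at *
    generalize hL : Real.log (CS * g / ε) = L at *
    have hD : 0 < D := hδ.trans_le hδε
    -- The claimed logarithm dominates L: ε⁴ ≤ ε, and a small D ≥ δ is compensated by `CW` ≥ CS/δ.
    have hlog : L ≤ Real.log (max (CS + 1) (CS / δ) * g / (ε ^ 4 * D⁻¹)) := by
      rw [← hL]
      refine Real.log_le_log (by positivity) ?_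
      have h1 : CS ≤ max (CS + 1) (CS / δ) * D := by
        calc CS = CS / δ * δ := by field_simp
          _ ≤ _ := by gcongr; exact le_max_right _ _
      have h2 : ε ^ 4 ≤ ε := pow_le_of_le_one hε.le hε1.le (by norm_num)
      calc CS * g / ε ≤ max (CS + 1) (CS / δ) * D * g / ε ^ 4 := by gcongr
        _ = _ := by field_simp
    rw [hdq]
    have hwork : 𝒲 ≤ C' * L ^ q := by
      have hLq : L ^ q = L ^ ((d : ℝ) / t + 3 * d + 1) * L := by
        rw [hq]; exact Real.rpow_add_one (by linarith) _
      calc 𝒲 ≤ (n + 1) * ((|Csolve| + 1) * (C * L ^ ((d : ℝ) / t + 3 * d + 1))) := hwork'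
        _ ≤ C * L * ((|Csolve| + 1) * (C * L ^ ((d : ℝ) / t + 3 * d + 1))) := by gcongr
        _ = C' * L ^ q := by rw [hLq, hC']; ring
    refine hwork.trans (DynGal.mul_rpow_le_mul_rpow hv.le (by linarith) hlog hq1 ?_ ?_)
    · rw [one_le_div hηW0]; linarith
    · rw [mul_one_div, le_div_iff₀ hηW0, mul_comm]
      exact (le_div_iff₀ hC'0).1 hηWv
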